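/- Let $k,d\ge 0$ and write $\Theta=(\mathbb R^d)^k$ for the space of $k$ cluster models. A \emph{round mechanism} $\mathcal M$ assigns to every finite set $S$ of selected clients and to the current models $\theta\in\Theta$ a probability distribution $\mathcal M(S,\theta)$ of the $k$ new models, measurably in $\theta$. For a client sampling rate $q\in[0,1]$, a number of rounds $T\ge 0$ and fixed initial models $\theta^0$, consider the algorithm which, on a finite set $D$ of clients, in each round $t=0,\dots,T-1$ draws with fresh randomness a set $M^t\subseteq D$ of clients and then $\theta^{t+1}\sim\mathcal M(M^t,\theta^t)$, and which returns $\theta^T$. RR-Cluster is this algorithm for the following $\mathcal M$: each client $i$ of the selected set $S$ computes, from its local data and $\theta$, a model update $\Delta_i\in\mathbb R^d$ and clustering information $s_i$; the $s_i$ are privatized to $\tilde s_i$; the selected clients are partitioned into $k$ groups $S_1,\dots,S_k$ on the basis of the $\tilde s_i$; uniformly random clients are moved from large groups (at least $B$ members) to small ones (fewer than $B$ members) so that each small group gets exactly $B$ members and every group keeps at least $B$ (if $S$ is too small for this, no client is moved); the updates are clipped, $\bar\Delta_i=\Delta_i/\max(1,\|\Delta_i\|/C)$ with $C>0$; and $\theta_j$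 is replaced by $\theta_j+\frac{\gamma}{|S_j|}\bigl(\sum_{i\in S_j}\bar\Delta_i+\mathcal N(0,(2C)^2\sigma^2 I_d)\bigr)$, with independent noises (and is left unchanged if $S_j=\emptyset$). The Rényi divergence of order $a>1$ of probability measures $\mu,\nu$ is $D_a(\mu\|\nu)=\frac1{a-1}\log\mathbb E_{\nu}\bigl[(d\mu/d\nu)^a\bigr]$, $D_\infty(\mu\|\nu)=\log\operatorname{ess\,sup}\frac{d\mu}{d\nu}$, and $+\infty$ if $\mu\not\ll\nu$. A mechanism $f$ on finite sets of clients is $(a,\varepsilon)$-RDP if $D_a(f(D)\|f(D'))\le\varepsilon$ for all adjacent $D,D'$. \textbf{Theorem.} Let $\alpha\ge2$ be an integer, let $\varepsilon_1,\varepsilon_2$ be functions of the order with values in $[0,\infty]$, and put $\varepsilon_{12}=\varepsilon_1+\varepsilon_2$. Suppose that, for every $\theta\in\Theta$, the mechanism $S\mapsto\mathcal M(S,\theta)$ is $(j,\varepsilon_{12}(j))$-RDP for each integer $2\le j\le\alpha$ and $(\infty,\varepsilon_{12}(\infty))$-RDP. Then the $T$-round algorithm $D\mapsto\theta^T$ is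 $(\alpha,\varepsilon(\alpha))$-RDP, where $$\begin{aligned}\varepsilon(\alpha)=\frac{T}{\alpha-1}\log\biggl(1&+q^2\binom{\alpha}{2}\min\Bigl\{4\bigl(e^{\varepsilon_{12}(2)}-1\bigr),\ e^{\varepsilon_{12}(2)}\min\bigl\{2,(e^{\varepsilon_{12}(\infty)}-1)^2\bigr\}\Bigr\}\\&+\sum_{j=3}^{\alpha}q^j\binom{\alpha}{j}e^{(j-1)\varepsilon_{12}(j)}\min\bigl\{2,(e^{\varepsilon_{12}(\infty)}-1)^j\bigr\}\biggr)\end{aligned}$$ (with $0\cdot\infty=0$). This holds in both of the following settings, in each of which the same adjacency is used in the assumption and in the conclusion: (i) two client sets are adjacent if one arises from the other by adding or removing one client, and $M^t$ contains each client of $D$ independently with probability $q$; (ii) two client sets are adjacent if one arises from the other by replacing one client with another, and $M^t$ is a uniformly random subset of $D$ with $q|D|$ elements (rounded down if $q|D|$ is not an integer). In particular it holds for RR-Cluster. -/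

import Mathlib

open MeasureTheory ProbabilityTheory
open scoped ENNReal NNReal

noncomputable section

namespace RRC

/-! ### Rényi divergence and Rényi differential privacy -/

/-- The Rényi divergence `D_a(μ ‖ ν)` of order `a ∈ (1, ∞]` of two probability measures:
`(a - 1)⁻¹ log 𝔼_ν[(dμ/dν)^a]` for finite `a`, and `log ess sup dμ/dν` for `a = ∞`;
it is `+∞` when `μ` is not absolutely continuous with respect to `ν`. -/
def renyiDiv {O : Type*} [MeasurableSpace O] (a : ℝ≥0∞) (μ ν : Measure O) : EReal :=
  open Classical in
  if μ ≪ ν then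
    if a = ⊤ then ENNReal.log (essSup (μ.rnDeriv ν) ν)
    else (((a.toReal - 1)⁻¹ : ℝ) : EReal) *
      ENNReal.log (∫⁻ x, (μ.rnDeriv ν x) ^ a.toReal ∂ν)
  else ⊤

/-- `mech` is `(a, ε)`-RDP on finite sets of clients, with respect to the adjacency `Adj`. -/
def IsRDP {X O : Type*} [MeasurableSpace O] (Adj : Finset X → Finset X → Prop)
    (mech : Finset X → Measure O) (a : ℝ≥0∞) (ε : EReal) : Prop :=
  ∀ D D' : Finset X, Adj D D' → renyiDiv a (mech D) (mech D') ≤ ε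

section Sampling

variable {X : Type*} [DecidableEq X]

/-- Adding or removing a single client. -/
def AddRemove (D D' : Finset X) : Prop :=
  ∃ x, (x ∉ D ∧ D' = insert x D) ∨ (x ∉ D' ∧ D = insert x D')

/-- Replacing a single client by another one. -/
def ReplaceOne (D D' : Finset X) : Prop :=
  ∃ (D₀ : Finset X) (x y : X), x ∉ D₀ ∧ y ∉ D₀ ∧ x ≠ y ∧ D = insert x D₀ ∧ D' = insert y D₀

theorem sum_poisson (q : ℝ≥0) (hq : q ≤ 1) (D : Finset X) :
    ∑ S ∈ D.powerset, ((q ^ S.card * (1 - q) ^ (D.card - S.card) : ℝ≥0) : ℝ≥0∞) = 1 := by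
  rw [← ENNReal.ofNNReal_finsetSum, Finset.sum_pow_mul_eq_add_pow, add_tsub_cancel_of_le hq,
    one_pow, ENNReal.coe_one]

/-- Poisson sampling: each client of `D` is selected independently with probability `q`. -/
def poissonSample (q : ℝ≥0) (hq : q ≤ 1) (D : Finset X) : PMF (Finset X) :=
  PMF.ofFinset
    (fun S => if S ⊆ D then ((q ^ S.card * (1 - q) ^ (D.card - S.card) : ℝ≥0) : ℝ≥0∞) else 0)
    D.powerset
    (by
      rw [← sum_poisson q hq D]
      refine Finset.sum_congr rfl fun S hS => ?_
      rw [if_pos (Finset.mem_powerset.mp hS)])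
    (fun S hS => if_neg fun h => hS (Finset.mem_powerset.mpr h))

theorem fixedSize_nonempty (q : ℝ≥0) (hq : q ≤ 1) (D : Finset X) :
    (D.powersetCard ⌊q * (D.card : ℝ≥0)⌋₊).Nonempty := by
  apply Finset.powersetCard_nonempty.mpr
  calc ⌊q * (D.card : ℝ≥0)⌋₊ ≤ ⌊((D.card : ℕ) : ℝ≥0)⌋₊ :=
        Nat.floor_le_floor (mul_le_of_le_one_left zero_le hq)
    _ = D.card := Nat.floor_natCast _

/-- Sampling without replacement: a uniformly random subset of `q |D|` clients of `D`
(rounded down if this is not an integer). -/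
def fixedSizeSample (q : ℝ≥0) (hq : q ≤ 1) (D : Finset X) : PMF (Finset X) :=
  PMF.uniformOfFinset (D.powersetCard ⌊q * (D.card : ℝ≥0)⌋₊) (fixedSize_nonempty q hq D)

end Sampling

/-! ### Round mechanisms, and their iteration on sampled clients -/

/-- `k` cluster models with parameters in `ℝ^d`. -/
abbrev Models (k d : ℕ) : Type := Fin k → EuclideanSpace ℝ (Fin d)

/-- A randomized mechanism for one communication round: from a finite set of selected clients
and the current `k` models it produces `k` new models. -/
structure RoundMechanism (X : Type*) (k d : ℕ) where
  toKernel : Finset X → Kernel (Models k d) (Models k d)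
  markov : ∀ S, IsMarkovKernel (toKernel S)

section Iteration

variable {X : Type*} {k d : ℕ}

/-- The round mechanism is RDP in the set of selected clients, for whatever current models, with
level `ε j` at each integer order `2 ≤ j ≤ α`, and with level `ε ∞` at order `∞`. -/
def RoundMechanism.IsRoundRDP (R : RoundMechanism X k d) (Adj : Finset X → Finset X → Prop)
    (α : ℕ) (ε : ℝ≥0∞ → ℝ≥0∞) : Prop :=
  ∀ θ : Models k d,
    (∀ j : ℕ, 2 ≤ j → j ≤ α → IsRDP Adj (fun S => R.toKernel S θ) (j : ℝ≥0∞) (ε j : EReal)) ∧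
    IsRDP Adj (fun S => R.toKernel S θ) ⊤ (ε ⊤ : EReal)

/-- One round: draw the selected clients among those of `D`, then apply the round mechanism
to them. The samplers used below only select clients of `D`. -/
def sampledRound (sample : Finset X → PMF (Finset X)) (R : RoundMechanism X k d)
    (D : Finset X) : Kernel (Models k d) (Models k d) where
  toFun θ := ∑ S ∈ D.powerset, sample D S • R.toKernel S θ
  measurable' := by
    refine Finset.measurable_sum _ fun S _ => ?_
    refine Measure.measurable_of_measurable_coe _ fun s hs => ?_
    simp only [Measure.smul_apply, smul_eq_mul]
    exact ((R.toKernel S).measurable_coe hs).const_mul _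

/-- The law of the `k` models returned after `T` rounds, each with freshly sampled clients, from
the initial models `θ₀`. -/
def runRounds (sample : Finset X → PMF (Finset X)) (R : RoundMechanism X k d)
    (θ₀ : Models k d) (D : Finset X) : ℕ → Measure (Models k d)
  | 0 => Measure.dirac θ₀
  | T + 1 => (runRounds sample R θ₀ D T).bind (sampledRound sample R D)

end Iteration

/-! ### The RR-Cluster round -/

/-- The data of RR-Cluster with `k` clusters, for clients in `X` (a client comes with its local
data): `S` is the type of the clustering information sent by a client and `S'` the type of its
privatized version. The clustering method (local computation, privatization of the clustering
information, partition rule) is arbitrary. -/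
structure RRCluster (X : Type*) (k d : ℕ) (S S' : Type*) [MeasurableSpace S]
    [MeasurableSpace S'] where
  /-- randomized local computation of a client: model update and clustering information -/
  localStep : X → Kernel (Models k d) (EuclideanSpace ℝ (Fin d) × S)
  localStep_markov : ∀ i, IsMarkovKernel (localStep i)
  /-- privatization of the clustering information of the selected clients -/
  privatize : ∀ D : Finset X, Kernel (D → S) (D → S')
  privatize_markov : ∀ D, IsMarkovKernel (privatize D)
  /-- partition of the selected clients into `k` groups -/
  partition : ∀ D : Finset X, (D → S') → (D → Fin k)
  partition_measurable : ∀ D, Measurable (partition D)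
  /-- rebalancing threshold -/
  B : ℕ
  /-- clipping bound -/
  C : ℝ
  C_pos : 0 < C
  /-- noise multiplier -/
  σ : ℝ
  /-- server step size -/
  γ : ℝ

/-- Size of group `j`. -/
def groupSize {ι : Type*} [Fintype ι] {k : ℕ} (c : ι → Fin k) (j : Fin k) : ℕ :=
  (Finset.univ.filter fun i => c i = j).card

/-- The rebalanced assignments: members are only moved from large groups (at least `B` members)
to small ones (less than `B` members), each small group is filled up to `B` members, and no group
is left with less than `B` members. -/
def rebalancedAssignments {ι : Type*} [Fintype ι] [DecidableEq ι] {k : ℕ} (B : ℕ)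
    (c : ι → Fin k) : Finset (ι → Fin k) :=
  Finset.univ.filter fun c' =>
    (∀ i, c' i ≠ c i → B ≤ groupSize c (c i) ∧ groupSize c (c' i) < B) ∧
    (∀ j, groupSize c j < B → groupSize c' j = B) ∧ (∀ j, B ≤ groupSize c' j)

/-- Uniformly random rebalancing. If too few clients are selected for a rebalancing to exist, the
assignment is kept. -/
def rebalance {ι : Type*} [Fintype ι] [DecidableEq ι] {k : ℕ} (B : ℕ) (c : ι → Fin k) :
    PMF (ι → Fin k) :=
  if h : (rebalancedAssignments B c).Nonempty then
    PMF.uniformOfFinset (rebalancedAssignments B c) h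
  else PMF.pure c

/-- Clipping to norm at most `C`. -/
def clip {d : ℕ} (C : ℝ) (v : EuclideanSpace ℝ (Fin d)) : EuclideanSpace ℝ (Fin d) :=
  (max 1 (‖v‖ / C))⁻¹ • v

/-- Product of finitely many Markov kernels: independent outputs given the input. -/
def kernelPi {ι A E : Type*} [Fintype ι] [MeasurableSpace A] [MeasurableSpace E]
    (κ : ι → Kernel A E) [∀ i, IsMarkovKernel (κ i)] : Kernel A (ι → E) where
  toFun a := Measure.pi fun i => κ i a
  measurable' := by
    refine Measurable.measure_of_isPiSystem_of_isProbabilityMeasure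
      (S := Set.pi Set.univ '' Set.pi Set.univ fun _ : ι => {s : Set E | MeasurableSet s})
      generateFrom_pi.symm isPiSystem_pi ?_
    rintro _ ⟨s, hs, rfl⟩
    simp only [Measure.pi_pi]
    exact Finset.measurable_prod _ fun i _ => (κ i).measurable_coe (hs i (Set.mem_univ i))

instance {ι A E : Type*} [Fintype ι] [MeasurableSpace A] [MeasurableSpace E]
    (κ : ι → Kernel A E) [∀ i, IsMarkovKernel (κ i)] : IsMarkovKernel (kernelPi κ) :=
  ⟨fun a => inferInstanceAs (IsProbabilityMeasure (Measure.pi fun i => κ i a))⟩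

namespace RRCluster

variable {X : Type*} [DecidableEq X] {k d : ℕ} {S S' : Type*} [MeasurableSpace S]
  [MeasurableSpace S'] (A : RRCluster X k d S S') (D : Finset X)

/-- The independent replies of the selected clients to the current models. -/
def replies : Kernel (Models k d) (D → EuclideanSpace ℝ (Fin d) × S) :=
  haveI : ∀ i : D, IsMarkovKernel (A.localStep i) := fun i => A.localStep_markov i
  kernelPi fun i : D => A.localStep i

/-- Groups of the selected clients after privatization, partition and rebalancing. -/
def groups : Kernel (D → EuclideanSpace ℝ (Fin d) × S) (D → Fin k) :=
  (Kernel.ofFunOfCountable fun c : D → Fin k => (rebalance A.B c).toMeasure) ∘ₖ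
    (((A.privatize D).map (A.partition D)).comap (fun r i => (r i).2) (by fun_prop))

/-- The server update `θ_j + γ |S_j|⁻¹ (∑_{i ∈ S_j} clip (Δ_i) + 2 C σ g_j)` of each model, from
the models `θ`, the replies, the groups and standard Gaussian vectors `g_j`. A model whose group
is empty does not change. -/
def serverUpdate
    (z : ((Models k d × (D → EuclideanSpace ℝ (Fin d) × S)) × (D → Fin k)) × Models k d) :
    Models k d := fun j =>
  z.1.1.1 j + (A.γ * (groupSize z.1.2 j : ℝ)⁻¹) •
    ((∑ i : D, if z.1.2 i = j then clip A.C (z.1.1.2 i).1 else 0) + (2 * A.C * A.σ) • z.2 j)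

theorem measurable_serverUpdate : Measurable (A.serverUpdate D) := by
  have hclip : Measurable (clip (d := d) A.C) := by unfold clip; fun_prop
  have hs : ∀ j, Measurable (fun c : D → Fin k => (groupSize c j : ℝ)) :=
    fun j => measurable_of_countable _
  refine measurable_pi_lambda _ fun j => ?_
  unfold serverUpdate
  have h1 : Measurable (fun z : ((Models k d × (D → EuclideanSpace ℝ (Fin d) × S)) ×
      (D → Fin k)) × Models k d => (groupSize z.1.2 j : ℝ)) := (hs j).comp (by fun_prop)
  have h2 : ∀ i : D, Measurable (fun z : ((Models k d × (D → EuclideanSpace ℝ (Fin d) × S)) ×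
      (D → Fin k)) × Models k d => if z.1.2 i = j then clip A.C (z.1.1.2 i).1 else 0) := by
    intro i
    refine Measurable.ite ?_ (hclip.comp (by fun_prop)) measurable_const
    exact measurableSet_eq_fun (by fun_prop) measurable_const
  have h3 := Finset.measurable_sum Finset.univ fun i _ => h2 i
  have h4 := (h1.inv.const_mul A.γ)
  fun_prop

/-- The new models, from current models, replies and groups: the noise vectors are independent
standard Gaussian vectors of `ℝ^d`. -/
def server :
    Kernel ((Models k d × (D → EuclideanSpace ℝ (Fin d) × S)) × (D → Fin k)) (Models k d) :=
  (Kernel.id ×ₖ Kernel.const _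
    (Measure.pi fun _ : Fin k => stdGaussian (EuclideanSpace ℝ (Fin d)))).map (A.serverUpdate D)

/-- The RR-Cluster round for the selected clients `D`. -/
def roundKernel : Kernel (Models k d) (Models k d) :=
  A.server D ∘ₖ ((Kernel.id ×ₖ (A.groups D).comap Prod.snd measurable_snd) ∘ₖ
    (Kernel.id ×ₖ A.replies D))

instance : IsMarkovKernel (A.replies D) := by
  haveI : ∀ i : D, IsMarkovKernel (A.localStep i) := fun i => A.localStep_markov i
  unfold replies; infer_instance

instance : IsMarkovKernel (A.groups D) := by
  have := A.privatize_markov D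
  have : IsMarkovKernel ((A.privatize D).map (A.partition D)) :=
    Kernel.IsMarkovKernel.map _ (A.partition_measurable D)
  have : IsMarkovKernel
      (Kernel.ofFunOfCountable fun c : D → Fin k => (rebalance A.B c).toMeasure) :=
    ⟨fun c => inferInstanceAs (IsProbabilityMeasure (rebalance A.B c).toMeasure)⟩
  unfold groups; infer_instance

instance : IsMarkovKernel (A.server D) :=
  Kernel.IsMarkovKernel.map _ (A.measurable_serverUpdate D)

/-- RR-Cluster as a round mechanism. -/
def round : RoundMechanism X k d where
  toKernel D := A.roundKernel D
  markov D := by unfold roundKernel; infer_instance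

end RRCluster

/-! ### The privacy level -/

/-- The moment sum for sampling rate `q` and order `α`, with values in `[0, ∞]`
(and `0 * ∞ = 0`). -/
def momentSum (q : ℝ≥0) (ε : ℝ≥0∞ → ℝ≥0∞) (α : ℕ) : ℝ≥0∞ :=
  1 + (q : ℝ≥0∞) ^ 2 * (α.choose 2 : ℝ≥0∞) *
      min (4 * (EReal.exp (ε 2) - 1))
        (EReal.exp (ε 2) * min 2 ((EReal.exp (ε ⊤) - 1) ^ 2))
    + ∑ j ∈ Finset.Icc 3 α, (q : ℝ≥0∞) ^ j * (α.choose j : ℝ≥0∞) *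
        EReal.exp ((((j - 1 : ℕ) : ℝ≥0∞) * ε j : ℝ≥0∞)) *
        min 2 ((EReal.exp (ε ⊤) - 1) ^ j)

/-- `T / (α - 1)` times the logarithm of the moment sum. -/
def totalLevel (q : ℝ≥0) (ε : ℝ≥0∞ → ℝ≥0∞) (T α : ℕ) : EReal :=
  (((T : ℝ) / ((α : ℝ) - 1) : ℝ) : EReal) * ENNReal.log (momentSum q ε α)

end RRC

end

namespace RRC

/-! ### Moment bounds in dual form -/

/-! One sampled round on `D` and on `D'` gives laws with densities `m` and `n` such that `n = ∑ w i
* r i` and `m - n = g * (∑ w i * p i - ∑ w i * q i)`. Here `p i`, `q i`, `r i` are outputs of the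
round mechanism on sets of selected clients that are pairwise equal or adjacent, and `g ≤ q` is the
probability that the differing client is selected. Expand `m ^ α / n ^ (α - 1)` binomially around `m
= n`. The zeroth term integrates to 1 and the first to 0, since both laws have mass 1. Joint
convexity of `(a, r) ↦ a ^ j / r ^ (j - 1)` bounds the `j`-th term by `g ^ j * α.choose j` times an
average of `∫ |p i - q i| ^ j / r i ^ (j - 1)` (`lintegral_mixture_pow_le`). These integrals are
bounded through the assumed divergences: `|p - q| ^ j ≤ p ^ j + q ^ j` gives the factor 2, `|p - q|
≤ (e^ε(∞) - 1) q` gives the power of `e^ε(∞) - 1`, and for `j = 2` comparing `p` and `q` with `r` in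
chi-square distance gives `4 (e^ε(2) - 1)`. `MomentBound.of_mixture` assembles this.

What remains is to find the decomposition for each sampler. For Poisson sampling one conditions on
the selection of the extra client. For sampling without replacement, a sample `S` of `D'` is coupled
with a uniform set `J` having one client fewer: `J` drops the replaced client if it is in `S`, and a
random member of `S` otherwise.

The one-round bound is uniform in the current models, so it composes adaptively: `MomentBound.bind`
multiplies constants, and the logarithm of the `T`-th power gives the factor `T`. No feature of
RR-Cluster is used beyond its being a round mechanism. -/

/-- Dual form of the bound `∫ (dμ/dν)^n dν ≤ c`: Hölder's inequality against powers of test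
functions. Unlike the primal form, it composes along kernels without disintegrating densities. -/
def MomentBound {O : Type*} [MeasurableSpace O] (n : ℕ) (c : ℝ≥0∞) (μ ν : Measure O) : Prop :=
  ∀ g : O → ℝ≥0∞, Measurable g →
    (∫⁻ x, g x ^ (n - 1) ∂μ) ^ n ≤ c * (∫⁻ x, g x ^ n ∂ν) ^ (n - 1)

section MomentBound

variable {O A : Type*} [MeasurableSpace O] [MeasurableSpace A]

theorem rpow_inv_natCast_pow_self {n : ℕ} (hn : n ≠ 0) (c : ℝ≥0∞) : (c ^ ((n : ℝ)⁻¹)) ^ n = c := by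
  rw [← ENNReal.rpow_natCast, ← ENNReal.rpow_mul, inv_mul_cancel₀ (Nat.cast_ne_zero.mpr hn),
    ENNReal.rpow_one]

/-- The kernel bound, applied to `g` at each `a`, leaves powers of the conditional norm `G a = (∫ g
^ n ∂L a) ^ (1 / n)`. This `G` is again a legitimate test function, now for `μ` and `ν`. -/
theorem MomentBound.bind {n : ℕ} (hn : n ≠ 0) {c c' : ℝ≥0∞} {μ ν : Measure A}
    (h : MomentBound n c μ ν) {K L : Kernel A O} (hKL : ∀ a, MomentBound n c' (K a) (L a)) :
    MomentBound n (c * c') (μ.bind K) (ν.bind L) := by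
  intro g hg
  rw [Measure.lintegral_bind K.measurable.aemeasurable (hg.pow_const _).aemeasurable,
    Measure.lintegral_bind L.measurable.aemeasurable (hg.pow_const _).aemeasurable]
  set G : A → ℝ≥0∞ := fun a => (∫⁻ x, g x ^ n ∂L a) ^ ((n : ℝ)⁻¹) with hG
  have hGm : Measurable G := ((hg.pow_const n).lintegral_kernel (κ := L)).pow_const _
  have hGn : ∀ a, G a ^ n = ∫⁻ x, g x ^ n ∂L a := fun a => rpow_inv_natCast_pow_self hn _
  have hpt : ∀ a, ∫⁻ x, g x ^ (n - 1) ∂K a ≤ c' ^ ((n : ℝ)⁻¹) * G a ^ (n - 1) := by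
    intro a
    rw [← (ENNReal.pow_right_strictMono hn).le_iff_le]
    calc _ ≤ c' * (∫⁻ x, g x ^ n ∂L a) ^ (n - 1) := hKL a g hg
      _ = _ := by rw [mul_pow, rpow_inv_natCast_pow_self hn, pow_right_comm, hGn]
  calc (∫⁻ a, ∫⁻ x, g x ^ (n - 1) ∂K a ∂μ) ^ n
      ≤ (∫⁻ a, c' ^ ((n : ℝ)⁻¹) * G a ^ (n - 1) ∂μ) ^ n := by
        gcongr with a; exact hpt a
    _ = c' * (∫⁻ a, G a ^ (n - 1) ∂μ) ^ n := by
        rw [lintegral_const_mul _ (hGm.pow_const _), mul_pow, rpow_inv_natCast_pow_self hn]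
    _ ≤ c' * (c * (∫⁻ a, G a ^ n ∂ν) ^ (n - 1)) := by gcongr; exact h G hGm
    _ = _ := by simp_rw [hGn]; ring

theorem momentBound_dirac (n : ℕ) (a : A) :
    MomentBound n 1 (Measure.dirac a) (Measure.dirac a) := by
  intro g hg
  rw [lintegral_dirac' _ (hg.pow_const _), lintegral_dirac' _ (hg.pow_const _), one_mul,
    ← pow_mul, ← pow_mul, mul_comm]

/-- The indicator of a `ν`-null set is the test function. With `n ≥ 2` the exponent `n - 1` is
nonzero, so the right-hand side vanishes. -/
theorem MomentBound.absolutelyContinuous {n : ℕ} (hn : 2 ≤ n) {c : ℝ≥0∞} {μ ν : Measure O}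
    (h : MomentBound n c μ ν) : μ ≪ ν := by
  refine Measure.AbsolutelyContinuous.mk fun s hs hν => ?_
  have h1 := h (s.indicator 1) (measurable_one.indicator hs)
  have h2 : ∀ k : ℕ, k ≠ 0 → (fun x => s.indicator (1 : O → ℝ≥0∞) x ^ k) = s.indicator 1 := by
    intro k hk
    ext x
    by_cases hx : x ∈ s <;> simp [hx, hk]
  rw [h2 _ (by omega), h2 _ (by omega), lintegral_indicator_one hs, lintegral_indicator_one hs, hν,
    zero_pow (by omega), mul_zero] at h1
  exact eq_zero_of_pow_eq_zero (le_antisymm h1 zero_le)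

/-- Back to the primal form: the density itself is extremal in Hölder's inequality. It is truncated
at `N` so that its moment `I` is finite and `I ^ n ≤ c * I ^ (n - 1)` can be cancelled; monotone
convergence then removes `N`. -/
theorem MomentBound.lintegral_rnDeriv_pow_le {n : ℕ} (hn : 2 ≤ n) {c : ℝ≥0∞} {μ ν : Measure O}
    [IsFiniteMeasure μ] [IsFiniteMeasure ν] (h : MomentBound n c μ ν) :
    ∫⁻ x, μ.rnDeriv ν x ^ n ∂ν ≤ c := by
  have hac := h.absolutelyContinuous hn
  have hm := μ.measurable_rnDeriv ν
  have key : ∀ N : ℕ, ∫⁻ x, min (μ.rnDeriv ν x) N ^ n ∂ν ≤ c := by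
    intro N
    have hgm : Measurable fun x => min (μ.rnDeriv ν x) (N : ℝ≥0∞) := hm.min measurable_const
    set I := ∫⁻ x, min (μ.rnDeriv ν x) N ^ n ∂ν with hI
    have hIt : I ≠ ⊤ := by
      refine ne_top_of_le_ne_top (b := ∫⁻ x, (N : ℝ≥0∞) ^ n ∂ν) ?_ ?_
      · rw [lintegral_const]
        exact ENNReal.mul_ne_top (by finiteness) (measure_ne_top _ _)
      · exact lintegral_mono fun x => by gcongr; exact min_le_right _ _
    have h1 : I ≤ ∫⁻ x, min (μ.rnDeriv ν x) (N : ℝ≥0∞) ^ (n - 1) ∂μ := by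
      rw [← lintegral_rnDeriv_mul hac (hgm.pow_const _).aemeasurable]
      refine lintegral_mono fun x => ?_
      obtain ⟨k, rfl⟩ : ∃ k, n = k + 1 := ⟨n - 1, by omega⟩
      simp only [Nat.add_sub_cancel, pow_succ']
      gcongr
      exact min_le_left _ _
    have h2 : I ^ n ≤ c * I ^ (n - 1) := (pow_le_pow_left₀ zero_le h1 n).trans (h _ hgm)
    rcases eq_or_ne I 0 with h0 | h0
    · rw [h0]; exact zero_le
    obtain ⟨k, rfl⟩ : ∃ k, n = k + 1 := ⟨n - 1, by omega⟩
    rw [Nat.add_sub_cancel, pow_succ'] at h2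
    exact (ENNReal.mul_le_mul_iff_left (pow_ne_zero _ h0) (ENNReal.pow_ne_top hIt)).mp h2
  have hsup : ∀ x, μ.rnDeriv ν x ^ n = ⨆ N : ℕ, min (μ.rnDeriv ν x) (N : ℝ≥0∞) ^ n := by
    intro x
    rw [← ENNReal.iSup_pow, ← inf_iSup_eq, ENNReal.iSup_natCast, inf_top_eq]
  simp_rw [hsup]
  rw [lintegral_iSup (fun N => (hm.min measurable_const).pow_const _)]
  · exact iSup_le key
  · intro N M hNM x
    dsimp only
    gcongr

/-- Hölder with exponents `n` and `n / (n - 1)` for the factorization `m g^(n-1) = (m / d^((n-1)/n))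
* (g d^(1/n))^(n-1)`. -/
theorem MomentBound.of_density {n : ℕ} (hn : 2 ≤ n) {ρ : Measure O} {m d : O → ℝ≥0∞}
    (hm : Measurable m) (hd : Measurable d) (hdt : ∀ᵐ x ∂ρ, d x ≠ ⊤)
    (h : ∫⁻ x, m x ^ n / d x ^ (n - 1) ∂ρ ≠ ⊤) :
    MomentBound n (∫⁻ x, m x ^ n / d x ^ (n - 1) ∂ρ) (ρ.withDensity m) (ρ.withDensity d) := by
  intro g hg
  rw [lintegral_withDensity_eq_lintegral_mul _ hm (hg.pow_const _),
    lintegral_withDensity_eq_lintegral_mul _ hd (hg.pow_const _)]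
  have hn0 : (n : ℝ) ≠ 0 := by positivity
  have hn0' : n ≠ 0 := by omega
  have hn1 : (1 : ℝ) < n := by exact_mod_cast (show 1 < n by omega)
  have hpq : (n : ℝ).HolderConjugate (n / (n - 1)) := Real.HolderConjugate.conjExponent hn1
  set u : O → ℝ≥0∞ := fun x => m x / (d x ^ ((n : ℝ)⁻¹)) ^ (n - 1) with hu
  set v : O → ℝ≥0∞ := fun x => (g x * d x ^ ((n : ℝ)⁻¹)) ^ (n - 1) with hv
  have hum : Measurable u := hm.div ((hd.pow_const _).pow_const _)
  have hvm : Measurable v := (hg.mul (hd.pow_const _)).pow_const _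
  have hH := ENNReal.lintegral_mul_le_Lp_mul_Lq ρ hpq hum.aemeasurable hvm.aemeasurable
  have e1 : ∀ x, u x ^ (n : ℝ) = m x ^ n / d x ^ (n - 1) := by
    intro x
    simp only [hu, ENNReal.rpow_natCast]
    rw [div_eq_mul_inv, mul_pow, ← ENNReal.inv_pow, ← div_eq_mul_inv, ← pow_mul,
      mul_comm, pow_mul, rpow_inv_natCast_pow_self hn0']
  have e2 : ∀ x, v x ^ ((n : ℝ) / (n - 1)) = d x * g x ^ n := by
    intro x
    have : ((n - 1 : ℕ) : ℝ) = n - 1 := by rw [Nat.cast_sub (by omega)]; simp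
    simp only [hv]
    rw [← ENNReal.rpow_natCast, ← ENNReal.rpow_mul, this, mul_div_cancel₀ _ (by linarith),
      ENNReal.rpow_natCast, mul_pow, rpow_inv_natCast_pow_self hn0', mul_comm]
  have e3 : ∫⁻ x, (m * fun x => g x ^ (n - 1)) x ∂ρ ≤ ∫⁻ x, (u * v) x ∂ρ := by
    refine lintegral_mono_ae ?_
    have hfin := ae_lt_top (hm.pow_const n |>.div (hd.pow_const _)) h
    filter_upwards [hdt, hfin] with x hx hx'
    simp only [Pi.mul_apply, hu, hv]
    rcases eq_or_ne (d x) 0 with h0 | h0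
    -- Where `d = 0` the factorization could fail, but `m ≠ 0` there would make the integrand
    -- infinite, which finiteness of the integral excludes almost everywhere.
    · rcases eq_or_ne (m x) 0 with h1 | h1
      · simp [h1]
      · exfalso
        rw [Pi.div_apply, h0, zero_pow (by omega), ENNReal.div_zero (pow_ne_zero _ h1)] at hx'
        exact lt_irrefl _ hx'
    · have hd0 : (d x ^ ((n : ℝ)⁻¹)) ^ (n - 1) ≠ 0 :=
        pow_ne_zero _ (by simp [ENNReal.rpow_eq_zero_iff, h0, hx])
      have hd1 : (d x ^ ((n : ℝ)⁻¹)) ^ (n - 1) ≠ ⊤ :=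
        ENNReal.pow_ne_top (ENNReal.rpow_ne_top_of_nonneg (by positivity) hx)
      rw [mul_pow, mul_comm (g x ^ (n - 1)), ← mul_assoc, ENNReal.div_mul_cancel hd0 hd1]
  simp_rw [e1, e2] at hH
  calc _ ≤ ((∫⁻ x, m x ^ n / d x ^ (n - 1) ∂ρ) ^ (1 / (n : ℝ)) *
        (∫⁻ x, d x * g x ^ n ∂ρ) ^ (1 / ((n : ℝ) / (n - 1)))) ^ n := by
        gcongr; exact e3.trans hH
    _ = _ := by
        have : ((n - 1 : ℕ) : ℝ) = n - 1 := by rw [Nat.cast_sub (by omega)]; simp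
        rw [mul_pow, one_div, rpow_inv_natCast_pow_self hn0', ← ENNReal.rpow_natCast (_ ^ _),
          ← ENNReal.rpow_mul, one_div_div, div_mul_cancel₀ _ hn0, ← this, ENNReal.rpow_natCast]
        rfl

end MomentBound

/-! ### Rényi divergence and moments of densities -/

section Renyi

variable {O : Type*} [MeasurableSpace O]

theorem rnDeriv_eq_mul_ae {μ ν ρ : Measure O} [IsFiniteMeasure μ] [IsFiniteMeasure ν]
    [IsFiniteMeasure ρ] (h : μ ≪ ν) :
    ∀ᵐ x ∂ρ, μ.rnDeriv ρ x = μ.rnDeriv ν x * ν.rnDeriv ρ x := by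
  filter_upwards [Measure.rnDeriv_mul_rnDeriv (κ := ρ) h] with x hx using hx.symm

/-- By the chain rule the moment does not depend on the dominating measure, so all pairs of
components can be compared over a single `ρ`. -/
theorem lintegral_rnDeriv_pow_div {n : ℕ} (hn : n ≠ 0) {μ ν ρ : Measure O} [IsFiniteMeasure μ]
    [IsFiniteMeasure ν] [IsFiniteMeasure ρ] (h : μ ≪ ν) (hν : ν ≪ ρ) :
    ∫⁻ x, μ.rnDeriv ρ x ^ n / ν.rnDeriv ρ x ^ (n - 1) ∂ρ = ∫⁻ x, μ.rnDeriv ν x ^ n ∂ν := by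
  rw [← lintegral_rnDeriv_mul hν ((μ.measurable_rnDeriv ν).pow_const n).aemeasurable]
  refine lintegral_congr_ae ?_
  filter_upwards [rnDeriv_eq_mul_ae (ρ := ρ) h, Measure.rnDeriv_lt_top ν ρ] with x hx hx'
  obtain ⟨k, rfl⟩ : ∃ k, n = k + 1 := ⟨n - 1, by omega⟩
  rw [hx, Nat.add_sub_cancel]
  rcases eq_or_ne (ν.rnDeriv ρ x) 0 with h0 | h0
  · simp [h0]
  · rw [mul_pow, pow_succ (ν.rnDeriv ρ x), mul_comm (ν.rnDeriv ρ x ^ k), ← mul_assoc,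
      ENNReal.mul_div_cancel_right (pow_ne_zero _ h0) (ENNReal.pow_ne_top hx'.ne), mul_comm]

theorem le_exp_of_log_le {x : ℝ≥0∞} {y : EReal} (h : ENNReal.log x ≤ y) : x ≤ EReal.exp y := by
  rw [← ENNReal.exp_log x]
  exact EReal.exp_monotone h

theorem absolutelyContinuous_of_renyiDiv_le {a : ℝ≥0∞} {μ ν : Measure O} {e : EReal}
    (h : renyiDiv a μ ν ≤ e) (he : e ≠ ⊤) : μ ≪ ν := by
  by_contra hac
  rw [renyiDiv, if_neg hac] at h
  exact he (top_le_iff.mp h)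

/-- A Rényi divergence bound of integer order bounds a moment of densities. -/
theorem lintegral_density_le_of_renyiDiv_le {n : ℕ} (hn : 2 ≤ n) {μ ν ρ : Measure O}
    [IsFiniteMeasure μ] [IsFiniteMeasure ν] [IsFiniteMeasure ρ] (hν : ν ≪ ρ) {e : ℝ≥0∞}
    (h : renyiDiv (n : ℝ≥0∞) μ ν ≤ (e : EReal)) :
    ∫⁻ x, μ.rnDeriv ρ x ^ n / ν.rnDeriv ρ x ^ (n - 1) ∂ρ ≤
      EReal.exp (((n - 1 : ℕ) : ℝ≥0∞) * e : ℝ≥0∞) := by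
  rcases eq_or_ne e ⊤ with rfl | he
  · rw [ENNReal.mul_top (by norm_cast; omega), EReal.coe_ennreal_top, EReal.exp_top]
    exact le_top
  have hac := absolutelyContinuous_of_renyiDiv_le h (by simpa using he)
  rw [lintegral_rnDeriv_pow_div (by omega) hac hν]
  rw [renyiDiv, if_pos hac, if_neg (ENNReal.natCast_ne_top n)] at h
  simp only [ENNReal.toReal_natCast, ENNReal.rpow_natCast] at h
  refine le_exp_of_log_le ?_
  have hn1 : (0 : ℝ) < (n : ℝ) - 1 := by
    have : (2 : ℝ) ≤ n := by exact_mod_cast hn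
    linarith
  have h2 := mul_le_mul_of_nonneg_left h (show (0 : EReal) ≤ (((n : ℝ) - 1 : ℝ) : EReal) by
    exact_mod_cast hn1.le)
  rw [← mul_assoc, ← EReal.coe_mul, mul_inv_cancel₀ hn1.ne', EReal.coe_one, one_mul] at h2
  refine h2.trans_eq ?_
  rw [EReal.coe_ennreal_mul]
  congr 1
  have : ((n : ℝ) - 1) = ((n - 1 : ℕ) : ℝ) := by rw [Nat.cast_sub (by omega)]; simp
  rw [this, ← ENNReal.coe_natCast]
  rfl

/-- A Rényi divergence bound of infinite order bounds ratios of densities. -/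
theorem density_le_of_renyiDiv_top_le {μ ν ρ : Measure O} [IsFiniteMeasure μ] [IsFiniteMeasure ν]
    [IsFiniteMeasure ρ] (hν : ν ≪ ρ) {e : ℝ≥0∞} (he : e ≠ ⊤)
    (h : renyiDiv ⊤ μ ν ≤ (e : EReal)) :
    ∀ᵐ x ∂ρ, μ.rnDeriv ρ x ≤ EReal.exp e * ν.rnDeriv ρ x := by
  have hac := absolutelyContinuous_of_renyiDiv_le h (by simpa using he)
  rw [renyiDiv, if_pos hac, if_pos rfl] at h
  have h1 : ∀ᵐ x ∂ν, μ.rnDeriv ν x ≤ EReal.exp e := by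
    filter_upwards [ENNReal.ae_le_essSup (μ.rnDeriv ν) (μ := ν)] with x hx
    exact hx.trans (le_exp_of_log_le h)
  -- A `ν`-a.e. bound transfers to `ρ` only where `dν/dρ ≠ 0`; elsewhere the chain rule makes both
  -- sides vanish.
  have h2 : ∀ᵐ x ∂ρ, ν.rnDeriv ρ x ≠ 0 → μ.rnDeriv ν x ≤ EReal.exp e := by
    rw [← ae_withDensity_iff (ν.measurable_rnDeriv ρ), Measure.withDensity_rnDeriv_eq _ _ hν]
    exact h1
  filter_upwards [rnDeriv_eq_mul_ae (ρ := ρ) hac, h2] with x hx hx2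
  rw [hx]
  rcases eq_or_ne (ν.rnDeriv ρ x) 0 with h0 | h0
  · simp [h0]
  · gcongr
    exact hx2 h0

/-- The Rényi divergence of measures that satisfy a moment bound. -/
theorem MomentBound.renyiDiv_le {n : ℕ} (hn : 2 ≤ n) {c : ℝ≥0∞} {μ ν : Measure O}
    [IsFiniteMeasure μ] [IsFiniteMeasure ν] (h : MomentBound n c μ ν) :
    renyiDiv (n : ℝ≥0∞) μ ν ≤ ((((n : ℝ) - 1)⁻¹ : ℝ) : EReal) * ENNReal.log c := by
  rw [renyiDiv, if_pos (h.absolutelyContinuous hn), if_neg (ENNReal.natCast_ne_top n)]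
  simp only [ENNReal.toReal_natCast, ENNReal.rpow_natCast]
  have hn1 : (0 : ℝ) ≤ ((n : ℝ) - 1)⁻¹ := by
    have : (2 : ℝ) ≤ n := by exact_mod_cast hn
    exact inv_nonneg.mpr (by linarith)
  exact mul_le_mul_of_nonneg_left (ENNReal.log_monotone (h.lintegral_rnDeriv_pow_le hn))
    (by exact_mod_cast hn1)

end Renyi

/-! ### Absolute differences in `[0, ∞]` -/

/-- The absolute difference of two elements of `[0, ∞]`. -/
def gap (a b : ℝ≥0∞) : ℝ≥0∞ := (a - b) + (b - a)

theorem gap_le {a b c : ℝ≥0∞} (h : a ≤ b + c) (h' : b ≤ a + c) : gap a b ≤ c := by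
  rcases le_total a b with hab | hab
  · rw [gap, tsub_eq_zero_of_le hab, zero_add]; exact tsub_le_iff_left.mpr h'
  · rw [gap, tsub_eq_zero_of_le hab, add_zero]; exact tsub_le_iff_left.mpr h

theorem gap_le_max (a b : ℝ≥0∞) : gap a b ≤ max a b :=
  gap_le ((le_max_left a b).trans le_add_self) ((le_max_right a b).trans le_add_self)

theorem gap_pow_le (a b : ℝ≥0∞) (j : ℕ) : gap a b ^ j ≤ a ^ j + b ^ j := by
  refine (pow_le_pow_left₀ zero_le (gap_le_max a b) j).trans ?_
  rcases le_total a b with hab | hab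
  · rw [max_eq_right hab]; exact le_add_self
  · rw [max_eq_left hab]; exact le_self_add

theorem le_add_gap_left (a b : ℝ≥0∞) : a ≤ b + gap a b :=
  le_add_tsub.trans (add_le_add_right le_self_add _)

theorem le_add_gap_right (a b : ℝ≥0∞) : b ≤ a + gap a b :=
  le_add_tsub.trans (add_le_add_right le_add_self _)

theorem gap_zero_right (a : ℝ≥0∞) : gap a 0 = a := by simp [gap]

theorem measurable_gap_pow_div {O : Type*} [MeasurableSpace O] {f g h : O → ℝ≥0∞}
    (hf : Measurable f) (hg : Measurable g) (hh : Measurable h) (j k : ℕ) :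
    Measurable fun x => gap (f x) (g x) ^ j / h x ^ k :=
  (((hf.sub hg).add (hg.sub hf)).pow_const _).div (hh.pow_const _)

/-- Only `b` appears on the right: when `a ≤ b`, `b - a ≤ (e - 1) a ≤ (e - 1) b`. -/
theorem gap_le_of_le_mul {a b e : ℝ≥0∞} (he : 1 ≤ e) (h : a ≤ e * b) (h' : b ≤ e * a) :
    gap a b ≤ (e - 1) * b := by
  obtain ⟨c, rfl⟩ := le_iff_exists_add.mp he
  have hc : c ≤ 1 + c - 1 := by
    rcases eq_or_ne c ⊤ with rfl | hc
    · simp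
    · rw [ENNReal.add_sub_cancel_left ENNReal.one_ne_top]
  rw [add_mul, one_mul] at h h'
  refine gap_le (h.trans (by gcongr)) ?_
  rcases le_total a b with hab | hab
  · exact h'.trans (by gcongr)
  · exact hab.trans le_self_add

theorem gap_coe (a b : ℝ≥0) : gap a b = ((a - b + (b - a) : ℝ≥0) : ℝ≥0∞) := by
  simp [gap]

theorem coe_sub_add_sub (a b : ℝ≥0) : ((a - b + (b - a) : ℝ≥0) : ℝ) = |(a : ℝ) - b| := by
  rcases le_total a b with hab | hab
  · rw [tsub_eq_zero_of_le hab, zero_add, NNReal.coe_sub hab, abs_sub_comm,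
      abs_of_nonneg (by simpa using hab)]
  · rw [tsub_eq_zero_of_le hab, add_zero, NNReal.coe_sub hab,
      abs_of_nonneg (by simpa using hab)]

theorem gap_le_gap_add_gap (a b c : ℝ≥0∞) : gap a b ≤ gap a c + gap b c := by
  refine gap_le ?_ ?_
  · calc a ≤ c + gap a c := le_add_gap_left _ _
      _ ≤ b + gap b c + gap a c := by gcongr; exact le_add_gap_right _ _
      _ = _ := by ring
  · calc b ≤ c + gap b c := le_add_gap_left _ _
      _ ≤ a + gap a c + gap b c := by gcongr; exact le_add_gap_right _ _
      _ = _ := by ring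

/-! ### Pointwise inequalities -/

/-- The first-order term `α (m - n)` is split between the two sides, so that the inequality can be
carried to `[0, ∞]`. From order 2 on, powers of `m - n` are replaced by powers of `|m - n|`. -/
theorem pow_div_pow_le_real {m n : ℝ} (hn : 0 < n) {α : ℕ} (hα : 2 ≤ α) :
    m ^ α / n ^ (α - 1) + α * n ≤
      n + α * m + ∑ j ∈ Finset.Icc 2 α, (α.choose j : ℝ) * (|m - n| ^ j / n ^ (j - 1)) := by
  have h1 : m ^ α / n ^ (α - 1) =
      ∑ j ∈ Finset.range (α + 1), (α.choose j : ℝ) * ((m - n) ^ j * n / n ^ j) := by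
    conv_lhs => rw [show m = (m - n) + n by ring, add_pow]
    rw [Finset.sum_div]
    refine Finset.sum_congr rfl fun j hj => ?_
    have hj' : j ≤ α := by simpa [Nat.lt_succ_iff] using hj
    rw [div_eq_iff (by positivity)]
    have : n ^ (α - j) * n ^ j = n * n ^ (α - 1) := by
      rw [← pow_add, ← pow_succ']; congr 1; omega
    field_simp
    linear_combination (α.choose j : ℝ) * (m - n) ^ j * this
  have h2 : Finset.range (α + 1) = insert 0 (insert 1 (Finset.Icc 2 α)) := by
    ext i; simp only [Finset.mem_range, Finset.mem_insert, Finset.mem_Icc]; omega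
  rw [h1, h2, Finset.sum_insert (by simp), Finset.sum_insert (by simp)]
  have h3 : ∑ j ∈ Finset.Icc 2 α, (α.choose j : ℝ) * ((m - n) ^ j * n / n ^ j) ≤
      ∑ j ∈ Finset.Icc 2 α, (α.choose j : ℝ) * (|m - n| ^ j / n ^ (j - 1)) := by
    refine Finset.sum_le_sum fun j hj => ?_
    obtain ⟨k, rfl⟩ : ∃ k, j = k + 1 := ⟨j - 1, by have := (Finset.mem_Icc.mp hj).1; omega⟩
    rw [Nat.add_sub_cancel, pow_succ n, mul_div_mul_right _ _ hn.ne', ← abs_pow]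
    gcongr
    exact le_abs_self _
  have h4 : (m - n) ^ 1 * n / n ^ 1 = m - n := by field_simp
  rw [h4]
  simp only [Nat.choose_zero_right, Nat.choose_one_right, pow_zero, Nat.cast_one]
  linarith

/-- Binomial expansion of `m ^ α / n ^ (α - 1)` around `m = n`. -/
theorem pow_div_pow_add_le {m n : ℝ≥0∞} (hm : m ≠ ⊤) (hn : n ≠ ⊤) {α : ℕ} (hα : 2 ≤ α) :
    m ^ α / n ^ (α - 1) + α * n ≤
      n + α * m + ∑ j ∈ Finset.Icc 2 α, (α.choose j : ℝ≥0∞) * (gap m n ^ j / n ^ (j - 1)) := by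
  rcases eq_or_ne n 0 with rfl | h0
  · rcases eq_or_ne m 0 with rfl | h1
    · rw [zero_pow (by omega)]; simp
    -- For `n = 0 ≠ m` the term `j = 2` on the right is `m ^ 2 / 0 = ∞`.
    · refine le_top.trans_eq (Eq.symm ?_)
      refine ENNReal.add_eq_top.mpr (Or.inr (ENNReal.sum_eq_top.mpr
        ⟨2, Finset.mem_Icc.mpr ⟨le_rfl, hα⟩, ?_⟩))
      rw [gap_zero_right, zero_pow (by norm_num), ENNReal.div_zero (pow_ne_zero _ h1),
        ENNReal.mul_top]
      exact_mod_cast (Nat.choose_pos hα).ne'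
  lift m to ℝ≥0 using hm
  lift n to ℝ≥0 using hn
  have hn0 : n ≠ 0 := by exact_mod_cast h0
  have hc : ∀ k : ℕ, ∀ a : ℝ≥0, (a : ℝ≥0∞) / (n : ℝ≥0∞) ^ k = ((a / n ^ k : ℝ≥0) : ℝ≥0∞) := by
    intro k a
    rw [ENNReal.coe_div (pow_ne_zero k hn0), ENNReal.coe_pow]
  have key : m ^ α / n ^ (α - 1) + α * n ≤ n + α * m +
      ∑ j ∈ Finset.Icc 2 α, (α.choose j : ℝ≥0) * ((m - n + (n - m)) ^ j / n ^ (j - 1)) := by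
    have := pow_div_pow_le_real (m := m) (n := n) (by positivity) hα
    rw [← NNReal.coe_le_coe]
    simp only [NNReal.coe_add, NNReal.coe_mul, NNReal.coe_div, NNReal.coe_pow, NNReal.coe_natCast,
      NNReal.coe_sum]
    simp only [← NNReal.coe_add, coe_sub_add_sub]
    exact_mod_cast this
  have h := ENNReal.coe_le_coe.mpr key
  simp only [ENNReal.coe_add, ENNReal.coe_mul, ENNReal.ofNNReal_finsetSum, ← hc, ENNReal.coe_pow,
    ENNReal.coe_natCast] at h
  simpa only [gap_coe, ENNReal.coe_add] using h

/-- Joint convexity of `(a, r) ↦ a ^ j / r ^ (j - 1)`. -/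
theorem sum_pow_div_sum_pow_le {ι : Type*} (s : Finset ι) (w a r : ι → ℝ≥0∞)
    (hr : ∀ i ∈ s, r i ≠ ⊤) {j : ℕ} (hj : 2 ≤ j) :
    (∑ i ∈ s, w i * a i) ^ j / (∑ i ∈ s, w i * r i) ^ (j - 1) ≤
      ∑ i ∈ s, w i * (a i ^ j / r i ^ (j - 1)) := by
  have hj0 : (j : ℝ) ≠ 0 := by positivity
  -- A component of positive weight with `r = 0 ≠ a` makes the right-hand side infinite. Without
  -- one, `a` can be written as `r * (a / r)` wherever the weight is nonzero.
  by_cases hz : ∃ i ∈ s, w i ≠ 0 ∧ r i = 0 ∧ a i ≠ 0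
  · obtain ⟨i, hi, hwi, hri, hai⟩ := hz
    refine le_top.trans_eq (Eq.symm (ENNReal.sum_eq_top.mpr ⟨i, hi, ?_⟩))
    rw [hri, zero_pow (by omega), ENNReal.div_zero (pow_ne_zero _ hai), ENNReal.mul_top hwi]
  push Not at hz
  have hsum : ∑ i ∈ s, w i * a i = ∑ i ∈ s, (w i * r i) * (a i / r i) := by
    refine Finset.sum_congr rfl fun i hi => ?_
    rcases eq_or_ne (w i) 0 with h0 | h0
    · simp [h0]
    rcases eq_or_ne (r i) 0 with h1 | h1
    · simp [hz i hi h0 h1]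
    rw [mul_assoc, ENNReal.mul_div_cancel h1 (hr i hi)]
  have hterm : ∀ i ∈ s, (w i * r i) * (a i / r i) ^ (j : ℝ) = w i * (a i ^ j / r i ^ (j - 1)) := by
    intro i hi
    rw [ENNReal.rpow_natCast]
    obtain ⟨k, rfl⟩ : ∃ k, j = k + 1 := ⟨j - 1, by omega⟩
    rw [Nat.add_sub_cancel]
    rcases eq_or_ne (w i) 0 with h0 | h0
    · simp [h0]
    rcases eq_or_ne (r i) 0 with h1 | h1
    · simp [hz i hi h0 h1]
    rw [pow_succ (a i / r i), mul_assoc, mul_comm ((a i / r i) ^ k), ← mul_assoc (r i),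
      ENNReal.mul_div_cancel h1 (hr i hi), div_eq_mul_inv, div_eq_mul_inv, mul_pow,
      ← ENNReal.inv_pow, pow_succ' (a i), mul_assoc (a i)]
  -- Weighted Hölder for the ratios `a i / r i` with weights `w i * r i`.
  have hH := ENNReal.inner_le_weight_mul_Lp_of_nonneg s (p := j)
    (by exact_mod_cast (show 1 ≤ j by omega)) (fun i => w i * r i) (fun i => a i / r i)
  rw [← hsum, Finset.sum_congr rfl hterm] at hH
  have hH2 : (∑ i ∈ s, w i * a i) ^ j ≤
      (∑ i ∈ s, w i * r i) ^ (j - 1) * ∑ i ∈ s, w i * (a i ^ j / r i ^ (j - 1)) := by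
    refine (pow_le_pow_left₀ zero_le hH j).trans_eq ?_
    rw [mul_pow, rpow_inv_natCast_pow_self (by omega), ← ENNReal.rpow_natCast (_ ^ _),
      ← ENNReal.rpow_mul, sub_mul, one_mul, inv_mul_cancel₀ hj0,
      show (j : ℝ) - 1 = ((j - 1 : ℕ) : ℝ) by rw [Nat.cast_sub (by omega)]; simp,
      ENNReal.rpow_natCast]
  exact ENNReal.div_le_of_le_mul' hH2

/-! ### Bounds for a triple of densities -/

section Triple

variable {O : Type*} [MeasurableSpace O] {ρ : Measure O} {p q r : O → ℝ≥0∞}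

theorem lintegral_gap_pow_le_two_mul (hp : Measurable p) (hr : Measurable r)
    {j : ℕ} {c : ℝ≥0∞} (hpr : ∫⁻ x, p x ^ j / r x ^ (j - 1) ∂ρ ≤ c)
    (hqr : ∫⁻ x, q x ^ j / r x ^ (j - 1) ∂ρ ≤ c) :
    ∫⁻ x, gap (p x) (q x) ^ j / r x ^ (j - 1) ∂ρ ≤ c * 2 := by
  calc _ ≤ ∫⁻ x, p x ^ j / r x ^ (j - 1) + q x ^ j / r x ^ (j - 1) ∂ρ := by
        refine lintegral_mono fun x => ?_
        rw [ENNReal.div_add_div_same]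
        gcongr
        exact gap_pow_le _ _ _
    _ ≤ c * 2 := by
        have hm : Measurable fun x => p x ^ j / r x ^ (j - 1) :=
          (hp.pow_const _).div (hr.pow_const _)
        rw [lintegral_add_left hm, mul_two]
        gcongr

theorem lintegral_gap_pow_le_sub_one_pow {j : ℕ} {c e : ℝ≥0∞} (he : 1 ≤ e)
    (he' : e ≠ ⊤)
    (hqr : ∫⁻ x, q x ^ j / r x ^ (j - 1) ∂ρ ≤ c) (hpq : ∀ᵐ x ∂ρ, p x ≤ e * q x)
    (hqp : ∀ᵐ x ∂ρ, q x ≤ e * p x) :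
    ∫⁻ x, gap (p x) (q x) ^ j / r x ^ (j - 1) ∂ρ ≤ c * (e - 1) ^ j := by
  calc _ ≤ ∫⁻ x, (e - 1) ^ j * (q x ^ j / r x ^ (j - 1)) ∂ρ := by
        refine lintegral_mono_ae ?_
        filter_upwards [hpq, hqp] with x h1 h2
        rw [← mul_div_assoc, ← mul_pow]
        gcongr
        exact gap_le_of_le_mul he h1 h2
    _ = (e - 1) ^ j * ∫⁻ x, q x ^ j / r x ^ (j - 1) ∂ρ :=
        lintegral_const_mul' _ _ (ENNReal.pow_ne_top (ENNReal.sub_ne_top he'))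
    _ ≤ _ := by rw [mul_comm]; gcongr

/-- Subtraction-free form of `(a - b)² / b = a² / b - 2 a + b`. For probability densities it
integrates to the chi-square identity `∫ (p - r)² / r = ∫ p² / r - 1`. -/
theorem gap_sq_div_add {a b : ℝ≥0∞} (ha : a ≠ ⊤) (hb : b ≠ ⊤) :
    gap a b ^ 2 / b + 2 * a = a ^ 2 / b + b := by
  rcases eq_or_ne b 0 with rfl | h0
  · rcases eq_or_ne a 0 with rfl | h1
    · simp [gap]
    · rw [gap_zero_right, ENNReal.div_zero (pow_ne_zero _ h1)]; simp
  lift a to ℝ≥0 using ha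
  lift b to ℝ≥0 using hb
  have hb0 : b ≠ 0 := by exact_mod_cast h0
  rw [gap_coe, ← ENNReal.coe_pow, ← ENNReal.coe_pow, ← ENNReal.coe_div hb0, ← ENNReal.coe_div hb0]
  have : (a - b + (b - a)) ^ 2 / b + 2 * a = a ^ 2 / b + b := by
    rw [← NNReal.coe_inj, NNReal.coe_add, NNReal.coe_div, NNReal.coe_pow, coe_sub_add_sub, sq_abs]
    push_cast
    have : (b : ℝ) ≠ 0 := by exact_mod_cast hb0
    field_simp
    ring
  exact_mod_cast congrArg ((↑) : ℝ≥0 → ℝ≥0∞) this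

theorem lintegral_gap_sq_le_sub_one (hp : Measurable p) (hr : Measurable r)
    (hp1 : ∫⁻ x, p x ∂ρ = 1) (hr1 : ∫⁻ x, r x ∂ρ = 1) {c : ℝ≥0∞}
    (hpr : ∫⁻ x, p x ^ 2 / r x ∂ρ ≤ c) : ∫⁻ x, gap (p x) (r x) ^ 2 / r x ∂ρ ≤ c - 1 := by
  have h : ∫⁻ x, gap (p x) (r x) ^ 2 / r x + 2 * p x ∂ρ = ∫⁻ x, p x ^ 2 / r x + r x ∂ρ := by
    refine lintegral_congr_ae ?_
    filter_upwards [ae_lt_top hp (by simp [hp1]), ae_lt_top hr (by simp [hr1])] with x h1 h2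
    exact gap_sq_div_add h1.ne h2.ne
  rw [lintegral_add_right _ (hp.const_mul 2), lintegral_add_right _ hr,
    lintegral_const_mul _ hp, hp1, hr1, mul_one] at h
  refine ENNReal.le_sub_of_add_le_right ENNReal.one_ne_top ?_
  have h2 : ∫⁻ x, gap (p x) (r x) ^ 2 / r x ∂ρ + 1 + 1 ≤ c + 1 := by
    rw [add_assoc, one_add_one_eq_two, h]
    gcongr
  exact (ENNReal.add_le_add_iff_right ENNReal.one_ne_top).mp h2

/-- `(p - q)² ≤ 2 (p - r)² + 2 (q - r)²`, and each of the two chi-square distances to `r` is at most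
`c - 1`. -/
theorem lintegral_gap_sq_le_four_mul (hp : Measurable p) (hq : Measurable q) (hr : Measurable r)
    (hp1 : ∫⁻ x, p x ∂ρ = 1) (hq1 : ∫⁻ x, q x ∂ρ = 1) (hr1 : ∫⁻ x, r x ∂ρ = 1) {c : ℝ≥0∞}
    (hpr : ∫⁻ x, p x ^ 2 / r x ∂ρ ≤ c) (hqr : ∫⁻ x, q x ^ 2 / r x ∂ρ ≤ c) :
    ∫⁻ x, gap (p x) (q x) ^ 2 / r x ∂ρ ≤ 4 * (c - 1) := by
  have hsq : ∀ a b : ℝ≥0∞, (a + b) ^ 2 ≤ 2 * (a ^ 2 + b ^ 2) := by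
    intro a b
    rcases le_total a b with hab | hab
    · obtain ⟨t, rfl⟩ := le_iff_exists_add.mp hab
      calc (a + (a + t)) ^ 2 ≤ (a + (a + t)) ^ 2 + t ^ 2 := le_self_add
        _ = _ := by ring
    · obtain ⟨t, rfl⟩ := le_iff_exists_add.mp hab
      calc (b + t + b) ^ 2 ≤ (b + t + b) ^ 2 + t ^ 2 := le_self_add
        _ = _ := by ring
  have hpm : Measurable fun x => gap (p x) (r x) ^ 2 / r x := by
    simpa using measurable_gap_pow_div hp hr hr 2 1
  have hqm : Measurable fun x => gap (q x) (r x) ^ 2 / r x := by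
    simpa using measurable_gap_pow_div hq hr hr 2 1
  calc _ ≤ ∫⁻ x, 2 * (gap (p x) (r x) ^ 2 / r x + gap (q x) (r x) ^ 2 / r x) ∂ρ := by
        refine lintegral_mono fun x => ?_
        rw [ENNReal.div_add_div_same, ← mul_div_assoc]
        gcongr
        exact (pow_le_pow_left₀ zero_le (gap_le_gap_add_gap _ _ (r x)) 2).trans (hsq _ _)
    _ ≤ 2 * ((c - 1) + (c - 1)) := by
        rw [lintegral_const_mul' _ _ ENNReal.ofNat_ne_top, lintegral_add_left hpm]
        gcongr
        · exact lintegral_gap_sq_le_sub_one hp hr hp1 hr1 hpr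
        · exact lintegral_gap_sq_le_sub_one hq hr hq1 hr1 hqr
    _ = 4 * (c - 1) := by ring

end Triple

/-! ### Moments of mixtures -/

/-- If the densities `m` and `n = ∑ w i * r i` differ by `g` times the difference of the mixtures
of `p i` and of `q i`, the moments of `m / n` are controlled by those of `|p i - q i| / r i`. -/
theorem lintegral_mixture_pow_le {O : Type*} [MeasurableSpace O] {ρ : Measure O} {ι : Type*}
    {s : Finset ι} {w : ι → ℝ≥0∞} {p q r : ι → O → ℝ≥0∞} {m : O → ℝ≥0∞} {g : ℝ≥0∞} {α : ℕ}
    (hα : 2 ≤ α) (hw : ∑ i ∈ s, w i = 1) (hg : g ≠ ⊤) (hp : ∀ i, Measurable (p i))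
    (hq : ∀ i, Measurable (q i)) (hr : ∀ i, Measurable (r i)) (hm : Measurable m)
    (hq1 : ∀ i ∈ s, ∫⁻ x, q i x ∂ρ = 1) (hr1 : ∀ i ∈ s, ∫⁻ x, r i x ∂ρ = 1)
    (hm1 : ∫⁻ x, m x ∂ρ = 1)
    (hmn : ∀ᵐ x ∂ρ, m x + g * ∑ i ∈ s, w i * q i x =
      ∑ i ∈ s, w i * r i x + g * ∑ i ∈ s, w i * p i x)
    {b : ℕ → ℝ≥0∞} (hb : ∀ j ∈ Finset.Icc 2 α, ∀ i ∈ s,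
      ∫⁻ x, gap (p i x) (q i x) ^ j / r i x ^ (j - 1) ∂ρ ≤ b j) :
    ∫⁻ x, m x ^ α / (∑ i ∈ s, w i * r i x) ^ (α - 1) ∂ρ ≤
      1 + ∑ j ∈ Finset.Icc 2 α, g ^ j * (α.choose j : ℝ≥0∞) * b j := by
  have hwt : ∀ i ∈ s, w i ≠ ⊤ := fun i hi => by
    have := Finset.single_le_sum_of_canonicallyOrdered (f := w) hi
    rw [hw] at this
    exact ne_top_of_le_ne_top ENNReal.one_ne_top this
  set n : O → ℝ≥0∞ := fun x => ∑ i ∈ s, w i * r i x with hn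
  have hnm : Measurable n := Finset.measurable_sum _ fun i _ => (hr i).const_mul _
  have hn1 : ∫⁻ x, n x ∂ρ = 1 := by
    rw [lintegral_finsetSum _ fun i _ => (hr i).const_mul _]
    rw [← hw]
    refine Finset.sum_congr rfl fun i hi => ?_
    rw [lintegral_const_mul _ (hr i), hr1 i hi, mul_one]
  have hgap : ∀ i j, Measurable fun x => gap (p i x) (q i x) ^ j / r i x ^ (j - 1) :=
    fun i j => measurable_gap_pow_div (hp i) (hq i) (hr i) j _
  have hqt : ∀ᵐ x ∂ρ, ∀ i ∈ s, q i x < ⊤ :=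
    (Finset.eventually_all s).mpr fun i hi => ae_lt_top (hq i) (by simp [hq1 i hi])
  have hrt : ∀ᵐ x ∂ρ, ∀ i ∈ s, r i x < ⊤ :=
    (Finset.eventually_all s).mpr fun i hi => ae_lt_top (hr i) (by simp [hr1 i hi])
  have hpt : ∀ᵐ x ∂ρ, m x ^ α / n x ^ (α - 1) + α * n x ≤ n x + α * m x +
      ∑ j ∈ Finset.Icc 2 α, (α.choose j : ℝ≥0∞) *
        (g ^ j * ∑ i ∈ s, w i * (gap (p i x) (q i x) ^ j / r i x ^ (j - 1))) := by
    filter_upwards [hmn, hqt, hrt, ae_lt_top hm (by simp [hm1]),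
      ae_lt_top hnm (by simp [hn1])] with x hx hqx hrx hmx hnx
    refine (pow_div_pow_add_le hmx.ne hnx.ne hα).trans ?_
    have hgx : gap (m x) (n x) ≤ g * ∑ i ∈ s, w i * gap (p i x) (q i x) := by
      have hqf : g * ∑ i ∈ s, w i * q i x ≠ ⊤ := ENNReal.mul_ne_top hg
        (ENNReal.sum_ne_top.mpr fun i hi => ENNReal.mul_ne_top (hwt i hi) (hqx i hi).ne)
      -- No mass is prescribed for the `p i`; finiteness of their mixture is read off from the
      -- identity `hmn`.
      have hpf : g * ∑ i ∈ s, w i * p i x ≠ ⊤ := by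
        refine ne_top_of_le_ne_top ?_ (le_add_self.trans_eq hx.symm)
        exact ENNReal.add_ne_top.mpr ⟨hmx.ne, hqf⟩
      refine gap_le ?_ ?_
      · rw [← ENNReal.add_le_add_iff_right hqf, hx, add_assoc, ← mul_add, ← Finset.sum_add_distrib]
        simp_rw [← mul_add]
        gcongr with i hi
        rw [add_comm]
        exact le_add_gap_left _ _
      · rw [← ENNReal.add_le_add_iff_right hpf, ← hx, add_assoc, ← mul_add,
          ← Finset.sum_add_distrib]
        simp_rw [← mul_add]
        gcongr with i hi
        rw [add_comm]
        exact le_add_gap_right _ _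
    refine add_le_add_right (Finset.sum_le_sum fun j hj => ?_) _
    gcongr
    calc gap (m x) (n x) ^ j / n x ^ (j - 1)
        ≤ (g * ∑ i ∈ s, w i * gap (p i x) (q i x)) ^ j / n x ^ (j - 1) := by gcongr
      _ = g ^ j * ((∑ i ∈ s, w i * gap (p i x) (q i x)) ^ j / n x ^ (j - 1)) := by
          rw [mul_pow, mul_div_assoc]
      _ ≤ _ := by
          gcongr
          exact sum_pow_div_sum_pow_le s w _ _ (fun i hi => (hrx i hi).ne)
            (Finset.mem_Icc.mp hj).1
  have hint := lintegral_mono_ae hpt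
  rw [lintegral_add_right _ (hnm.const_mul _), lintegral_const_mul _ hnm, hn1,
    lintegral_add_left (f := fun x => n x + α * m x) (hnm.add (hm.const_mul _)),
    lintegral_add_left hnm,
    lintegral_const_mul _ hm, hn1, hm1, mul_one, add_right_comm] at hint
  -- As `m` and `n` have mass 1, the first-order terms contribute `α` to each side and cancel.
  refine ((ENNReal.add_le_add_iff_right (ENNReal.natCast_ne_top α)).mp hint).trans ?_
  refine add_le_add_right ?_ _
  rw [lintegral_finsetSum _ fun j _ => ((Finset.measurable_sum _ fun i _ =>
    (hgap i j).const_mul _).const_mul _).const_mul _]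
  refine Finset.sum_le_sum fun j hj => ?_
  rw [lintegral_const_mul _ ((Finset.measurable_sum _ fun i _ =>
    (hgap i j).const_mul _).const_mul _), lintegral_const_mul _ (Finset.measurable_sum _ fun i _ =>
    (hgap i j).const_mul _), lintegral_finsetSum _ fun i _ => (hgap i j).const_mul _, 
    mul_comm (g ^ j) (α.choose j : ℝ≥0∞), mul_assoc]
  gcongr
  calc ∑ i ∈ s, ∫⁻ x, w i * (gap (p i x) (q i x) ^ j / r i x ^ (j - 1)) ∂ρ
      ≤ ∑ i ∈ s, w i * b j := by
        refine Finset.sum_le_sum fun i hi => ?_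
        rw [lintegral_const_mul _ (hgap i j)]
        gcongr
        exact hb j hj i hi
    _ = b j := by rw [← Finset.sum_mul, hw, one_mul]

/-! ### Mixtures of probability measures -/

theorem MomentBound.mono {O : Type*} [MeasurableSpace O] {n : ℕ} {c c' : ℝ≥0∞} {μ ν : Measure O}
    (h : MomentBound n c μ ν) (hc : c ≤ c') : MomentBound n c' μ ν :=
  fun g hg => (h g hg).trans (by gcongr)

theorem momentSum_mono {q q' : ℝ≥0} (h : q ≤ q') (ε : ℝ≥0∞ → ℝ≥0∞) (α : ℕ) :
    momentSum q ε α ≤ momentSum q' ε α := by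
  have h' : (q : ℝ≥0∞) ≤ q' := by exact_mod_cast h
  unfold momentSum
  gcongr

theorem renyiDiv_self_le {O : Type*} [MeasurableSpace O] (a : ℝ≥0∞) (μ : Measure O)
    [IsProbabilityMeasure μ] (e : ℝ≥0∞) : renyiDiv a μ μ ≤ (e : EReal) := by
  refine le_trans (b := 0) ?_ (EReal.coe_ennreal_nonneg e)
  rw [renyiDiv, if_pos Measure.AbsolutelyContinuous.rfl]
  split_ifs with ha
  · rw [← ENNReal.log_one]
    refine ENNReal.log_monotone (essSup_le_of_ae_le _ ?_)
    filter_upwards [μ.rnDeriv_self] with x hx using hx.le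
  · have : ∫⁻ x, μ.rnDeriv μ x ^ a.toReal ∂μ = 1 := by
      rw [← measure_univ (μ := μ), ← lintegral_one]
      refine lintegral_congr_ae ?_
      filter_upwards [μ.rnDeriv_self] with x hx
      rw [hx, ENNReal.one_rpow]
    rw [this, ENNReal.log_one, mul_zero]

theorem le_exp_coe (e : ℝ≥0∞) : 1 ≤ EReal.exp e := by
  rw [← EReal.exp_zero]
  exact EReal.exp_monotone (EReal.coe_ennreal_nonneg e)

theorem momentSum_eq (q : ℝ≥0) (ε : ℝ≥0∞ → ℝ≥0∞) {α : ℕ} (hα : 2 ≤ α) :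
    momentSum q ε α = 1 + ∑ j ∈ Finset.Icc 2 α, (q : ℝ≥0∞) ^ j * (α.choose j : ℝ≥0∞) *
      if j = 2 then min (4 * (EReal.exp (ε 2) - 1))
        (EReal.exp (ε 2) * min 2 ((EReal.exp (ε ⊤) - 1) ^ 2))
      else EReal.exp ((((j - 1 : ℕ) : ℝ≥0∞) * ε j : ℝ≥0∞)) *
        min 2 ((EReal.exp (ε ⊤) - 1) ^ j) := by
  have h : Finset.Icc 2 α = insert 2 (Finset.Icc 3 α) := by
    ext i; simp only [Finset.mem_insert, Finset.mem_Icc]; omega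
  rw [h, Finset.sum_insert (by simp), if_pos rfl, momentSum, add_assoc]
  congr 2
  refine Finset.sum_congr rfl fun j hj => ?_
  rw [if_neg (by have := (Finset.mem_Icc.mp hj).1; omega), mul_assoc]

/-- The one-round bound, independent of the sampler. `hμ` says `μ - ν = g * (∑ w i • π i - ∑ w i • κ
i)` without subtracting measures. Separating the components `ρ i` of `ν` from `π i` and `κ i` lets
the same statement serve both directions of add/remove and replacement. -/
theorem MomentBound.of_mixture {O ι : Type*} [MeasurableSpace O] {s : Finset ι} {w : ι → ℝ≥0∞}
    {π κ ρ : ι → Measure O} [∀ i, IsProbabilityMeasure (π i)] [∀ i, IsProbabilityMeasure (κ i)]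
    [∀ i, IsProbabilityMeasure (ρ i)] {μ ν : Measure O} [IsProbabilityMeasure μ]
    {g : ℝ≥0} {α : ℕ} {ε : ℝ≥0∞ → ℝ≥0∞} (hα : 2 ≤ α) (hw : ∑ i ∈ s, w i = 1)
    (hν : ν = ∑ i ∈ s, w i • ρ i)
    (hμ : μ + (g : ℝ≥0∞) • ∑ i ∈ s, w i • κ i = ν + (g : ℝ≥0∞) • ∑ i ∈ s, w i • π i)
    (hπρ : ∀ i ∈ s, ∀ j : ℕ, 2 ≤ j → j ≤ α → renyiDiv (j : ℝ≥0∞) (π i) (ρ i) ≤ (ε j : EReal))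
    (hκρ : ∀ i ∈ s, ∀ j : ℕ, 2 ≤ j → j ≤ α → renyiDiv (j : ℝ≥0∞) (κ i) (ρ i) ≤ (ε j : EReal))
    (hπκ : ∀ i ∈ s, renyiDiv ⊤ (π i) (κ i) ≤ (ε ⊤ : EReal))
    (hκπ : ∀ i ∈ s, renyiDiv ⊤ (κ i) (π i) ≤ (ε ⊤ : EReal))
    (hM : momentSum g ε α ≠ ⊤) :
    MomentBound α (momentSum g ε α) μ ν := by
  subst hν
  set l : Measure O := ∑ i ∈ s, (π i + κ i + ρ i) with hl
  have hle : ∀ i ∈ s, π i + κ i + ρ i ≤ l := fun i hi =>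
    Measure.le_iff'.mpr fun A => by
      rw [hl, Measure.finsetSum_apply]
      exact Finset.single_le_sum_of_canonicallyOrdered (f := fun i => (π i + κ i + ρ i) A) hi
  have hπl : ∀ i ∈ s, π i ≪ l := fun i hi =>
    Measure.absolutelyContinuous_of_le ((Measure.le_add_right (Measure.le_add_right le_rfl)).trans
      (hle i hi))
  have hκl : ∀ i ∈ s, κ i ≪ l := fun i hi =>
    Measure.absolutelyContinuous_of_le ((Measure.le_add_right (Measure.le_add_left le_rfl)).trans
      (hle i hi))
  have hρl : ∀ i ∈ s, ρ i ≪ l := fun i hi =>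
    Measure.absolutelyContinuous_of_le ((Measure.le_add_left le_rfl).trans (hle i hi))
  have hmix : ∀ τ : ι → Measure O, (∀ i ∈ s, τ i ≪ l) → (∑ i ∈ s, w i • τ i) ≪ l := by
    intro τ hτ A hA
    rw [Measure.finsetSum_apply]
    refine Finset.sum_eq_zero fun i hi => ?_
    rw [Measure.smul_apply, hτ i hi hA, smul_zero]
  -- `μ` is not a summand of `l`; the relation `hμ` dominates it by components that are.
  have hμl : μ ≪ l := by
    refine (Measure.absolutelyContinuous_of_le (Measure.le_add_right le_rfl)).trans
      (hμ ▸ ?_ : μ + (g : ℝ≥0∞) • ∑ i ∈ s, w i • κ i ≪ l)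
    exact Measure.AbsolutelyContinuous.add_left (hmix ρ hρl)
      ((hmix π hπl).smul_left _)
  have hset : ∀ τ : ι → Measure O, (∀ i, IsProbabilityMeasure (τ i)) → (∀ i ∈ s, τ i ≪ l) →
      l.withDensity (fun x => ∑ i ∈ s, w i * (τ i).rnDeriv l x) = ∑ i ∈ s, w i • τ i := by
    intro τ _ hτ
    ext A hA
    rw [withDensity_apply _ hA, lintegral_finsetSum _ fun i _ =>
      ((τ i).measurable_rnDeriv l).const_mul _, Measure.finsetSum_apply]
    refine Finset.sum_congr rfl fun i hi => ?_
    rw [lintegral_const_mul _ ((τ i).measurable_rnDeriv l), Measure.setLIntegral_rnDeriv (hτ i hi),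
      Measure.smul_apply, smul_eq_mul]
  have hmeas : ∀ τ : ι → Measure O, Measurable fun x => ∑ i ∈ s, w i * (τ i).rnDeriv l x :=
    fun τ => Finset.measurable_sum _ fun i _ => ((τ i).measurable_rnDeriv l).const_mul _
  have hone : ∀ τ : Measure O, IsProbabilityMeasure τ → τ ≪ l → ∫⁻ x, τ.rnDeriv l x ∂l = 1 := by
    intro τ _ hτ
    rw [Measure.lintegral_rnDeriv hτ, measure_univ]
  have hmn : ∀ᵐ x ∂l, μ.rnDeriv l x + g * ∑ i ∈ s, w i * (κ i).rnDeriv l x =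
      ∑ i ∈ s, w i * (ρ i).rnDeriv l x + g * ∑ i ∈ s, w i * (π i).rnDeriv l x := by
    refine ae_eq_of_forall_setLIntegral_eq_of_sigmaFinite
      ((μ.measurable_rnDeriv l).add ((hmeas κ).const_mul _))
      ((hmeas ρ).add ((hmeas π).const_mul _)) fun A hA _ => ?_
    rw [lintegral_add_left (μ.measurable_rnDeriv l), lintegral_add_left (hmeas ρ),
      lintegral_const_mul _ (hmeas κ), lintegral_const_mul _ (hmeas π),
      Measure.setLIntegral_rnDeriv hμl, ← withDensity_apply _ hA, ← withDensity_apply _ hA,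
      ← withDensity_apply _ hA, hset κ inferInstance hκl, hset ρ inferInstance hρl,
      hset π inferInstance hπl]
    simpa only [Measure.add_apply, Measure.smul_apply, smul_eq_mul] using
      congrArg (fun τ : Measure O => τ A) hμ
  have hE := le_exp_coe (ε ⊤)
  have hbase : ∀ j : ℕ, 2 ≤ j → j ≤ α → ∀ i ∈ s,
      ∫⁻ x, gap ((π i).rnDeriv l x) ((κ i).rnDeriv l x) ^ j / (ρ i).rnDeriv l x ^ (j - 1) ∂l ≤
      EReal.exp ((((j - 1 : ℕ) : ℝ≥0∞) * ε j : ℝ≥0∞)) * min 2 ((EReal.exp (ε ⊤) - 1) ^ j) := by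
    intro j hj hjα i hi
    have h1 := lintegral_density_le_of_renyiDiv_le (ρ := l) hj (hρl i hi) (hπρ i hi j hj hjα)
    have h2 := lintegral_density_le_of_renyiDiv_le (ρ := l) hj (hρl i hi) (hκρ i hi j hj hjα)
    have h3 := lintegral_gap_pow_le_two_mul ((π i).measurable_rnDeriv l)
      ((ρ i).measurable_rnDeriv l) h1 h2
    rcases min_choice 2 ((EReal.exp (ε ⊤) - 1) ^ j) with h | h
    · rw [h]; exact h3
    -- With an infinite level at order `∞` the minimum is 2, so the first bound already suffices.
    rcases eq_or_ne (ε ⊤) ⊤ with htop | htop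
    · rw [htop, EReal.coe_ennreal_top, EReal.exp_top, ENNReal.top_sub ENNReal.one_ne_top,
        ENNReal.top_pow (by omega), min_top_right]
      exact h3
    rw [h]
    refine lintegral_gap_pow_le_sub_one_pow hE ?_ h2
      (density_le_of_renyiDiv_top_le (hκl i hi) htop (hπκ i hi))
      (density_le_of_renyiDiv_top_le (hπl i hi) htop (hκπ i hi))
    simpa using htop
  have hmain := lintegral_mixture_pow_le (ρ := l) (s := s) (w := w)
    (p := fun i => (π i).rnDeriv l) (q := fun i => (κ i).rnDeriv l)
    (r := fun i => (ρ i).rnDeriv l) (m := μ.rnDeriv l) (g := g) hα hw ENNReal.coe_ne_top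
    (fun i => (π i).measurable_rnDeriv l) (fun i => (κ i).measurable_rnDeriv l)
    (fun i => (ρ i).measurable_rnDeriv l) (μ.measurable_rnDeriv l)
    (fun i hi => hone _ inferInstance (hκl i hi)) (fun i hi => hone _ inferInstance (hρl i hi))
    (hone _ inferInstance hμl) hmn
    (b := fun j => if j = 2 then min (4 * (EReal.exp (ε 2) - 1))
        (EReal.exp (ε 2) * min 2 ((EReal.exp (ε ⊤) - 1) ^ 2))
      else EReal.exp ((((j - 1 : ℕ) : ℝ≥0∞) * ε j : ℝ≥0∞)) *
        min 2 ((EReal.exp (ε ⊤) - 1) ^ j)) (by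
      intro j hj i hi
      obtain ⟨hj2, hjα⟩ := Finset.mem_Icc.mp hj
      have hb := hbase j hj2 hjα i hi
      split_ifs with h2
      · subst h2
        refine le_min ?_ (by simpa using hb)
        have h1 := lintegral_density_le_of_renyiDiv_le (ρ := l) hj2 (hρl i hi)
          (hπρ i hi 2 hj2 hjα)
        have h2 := lintegral_density_le_of_renyiDiv_le (ρ := l) hj2 (hρl i hi)
          (hκρ i hi 2 hj2 hjα)
        simp only [Nat.add_one_sub_one, pow_one, Nat.cast_one, one_mul, Nat.cast_ofNat] at h1 h2 ⊢
        exact lintegral_gap_sq_le_four_mul ((π i).measurable_rnDeriv l)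
          ((κ i).measurable_rnDeriv l) ((ρ i).measurable_rnDeriv l)
          (hone _ inferInstance (hπl i hi)) (hone _ inferInstance (hκl i hi))
          (hone _ inferInstance (hρl i hi)) h1 h2
      · exact hb)
  rw [← momentSum_eq g ε hα] at hmain
  have hnt : ∀ᵐ x ∂l, ∑ i ∈ s, w i * (ρ i).rnDeriv l x ≠ ⊤ := by
    have hnl : ∫⁻ x, ∑ i ∈ s, w i * (ρ i).rnDeriv l x ∂l ≠ ⊤ := by
      rw [← setLIntegral_univ, ← withDensity_apply _ MeasurableSet.univ,
        hset ρ inferInstance hρl, Measure.finsetSum_apply]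
      simp [hw]
    filter_upwards [ae_lt_top (hmeas ρ) hnl] with x hx using hx.ne
  have hfin := MomentBound.of_density hα (μ.measurable_rnDeriv l) (hmeas ρ) hnt
    (ne_top_of_le_ne_top hM hmain)
  rw [hset ρ inferInstance hρl, Measure.withDensity_rnDeriv_eq _ _ hμl] at hfin
  exact hfin.mono hmain

/-! ### Sums over sampled sets -/

section Sums

variable {X : Type*} [DecidableEq X] {M : Type*} [AddCommMonoid M]

theorem sum_powersetCard_insert {D : Finset X} {x : X} (hx : x ∉ D) (m : ℕ) (f : Finset X → M) :
    ∑ S ∈ (insert x D).powersetCard (m + 1), f S =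
      ∑ S ∈ D.powersetCard (m + 1), f S + ∑ J ∈ D.powersetCard m, f (insert x J) := by
  rw [Finset.powersetCard_succ_insert hx, Finset.sum_union, Finset.sum_image]
  · intro J hJ J' hJ' h
    have h1 : x ∉ J := fun h => hx ((Finset.mem_powersetCard.mp hJ).1 h)
    have h2 : x ∉ J' := fun h => hx ((Finset.mem_powersetCard.mp hJ').1 h)
    rw [← Finset.erase_insert h1, ← Finset.erase_insert h2]
    exact congrArg (fun S => S.erase x) h
  · rw [Finset.disjoint_left]
    intro S hS hS'
    obtain ⟨J, -, rfl⟩ := Finset.mem_image.mp hS'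
    exact hx ((Finset.mem_powersetCard.mp hS).1 (Finset.mem_insert_self x J))

/-- Double counting: each set with `m + 1` elements arises once for every choice of its element `z`.
-/
theorem sum_powersetCard_sum_sdiff_insert (D : Finset X) (m : ℕ) (f : Finset X → M) :
    ∑ J ∈ D.powersetCard m, ∑ z ∈ D \ J, f (insert z J) =
      (m + 1) • ∑ S ∈ D.powersetCard (m + 1), f S := by
  have h : (m + 1) • ∑ S ∈ D.powersetCard (m + 1), f S =
      ∑ S ∈ D.powersetCard (m + 1), ∑ _z ∈ S, f S := by
    rw [← Finset.sum_nsmul]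
    refine Finset.sum_congr rfl fun S hS => ?_
    rw [Finset.sum_const, (Finset.mem_powersetCard.mp hS).2]
  rw [h, Finset.sum_sigma', Finset.sum_sigma']
  refine Finset.sum_bij' (fun a _ => ⟨insert a.2 a.1, a.2⟩) (fun a _ => ⟨a.1.erase a.2, a.2⟩)
    ?_ ?_ ?_ ?_ ?_
  · rintro ⟨J, z⟩ ha
    simp only [Finset.mem_sigma, Finset.mem_powersetCard, Finset.mem_sdiff] at ha ⊢
    exact ⟨⟨Finset.insert_subset ha.2.1 ha.1.1, by rw [Finset.card_insert_of_notMem ha.2.2, ha.1.2]⟩,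
      Finset.mem_insert_self _ _⟩
  · rintro ⟨S, z⟩ ha
    simp only [Finset.mem_sigma, Finset.mem_powersetCard, Finset.mem_sdiff] at ha ⊢
    exact ⟨⟨(Finset.erase_subset _ _).trans ha.1.1,
      by rw [Finset.card_erase_of_mem ha.2, ha.1.2, Nat.add_sub_cancel]⟩, ha.1.1 ha.2,
      Finset.notMem_erase _ _⟩
  · rintro ⟨J, z⟩ ha
    simp only [Finset.mem_sigma, Finset.mem_powersetCard, Finset.mem_sdiff] at ha ⊢
    rw [Finset.erase_insert ha.2.2]
  · rintro ⟨S, z⟩ ha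
    simp only [Finset.mem_sigma, Finset.mem_powersetCard] at ha ⊢
    rw [Finset.insert_erase ha.2]
  · rintro ⟨J, z⟩ ha
    rfl

theorem poissonSample_apply {q : ℝ≥0} {hq : q ≤ 1} {D S : Finset X} (hS : S ⊆ D) :
    poissonSample q hq D S = ((q ^ S.card * (1 - q) ^ (D.card - S.card) : ℝ≥0) : ℝ≥0∞) := by
  rw [poissonSample, PMF.ofFinset_apply, if_pos hS]

theorem sum_poissonSample (q : ℝ≥0) (hq : q ≤ 1) (D : Finset X) :
    ∑ S ∈ D.powerset, poissonSample q hq D S = 1 := by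
  rw [← sum_poisson q hq D]
  exact Finset.sum_congr rfl fun S hS => poissonSample_apply (Finset.mem_powerset.mp hS)

/-- Conditioning on whether `x` is selected. -/
theorem sum_poissonSample_insert {O : Type*} [MeasurableSpace O] {q : ℝ≥0} (hq : q ≤ 1)
    {D : Finset X} {x : X} (hx : x ∉ D) (f : Finset X → Measure O) :
    ∑ S ∈ (insert x D).powerset, poissonSample q hq (insert x D) S • f S =
      ((1 - q : ℝ≥0) : ℝ≥0∞) • ∑ S ∈ D.powerset, poissonSample q hq D S • f S +
      (q : ℝ≥0∞) • ∑ S ∈ D.powerset, poissonSample q hq D S • f (insert x S) := by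
  rw [Finset.sum_powerset_insert hx, Finset.smul_sum, Finset.smul_sum]
  congr 1 <;> refine Finset.sum_congr rfl fun S hS => ?_
  · have hS' := Finset.mem_powerset.mp hS
    rw [poissonSample_apply hS', poissonSample_apply (hS'.trans (Finset.subset_insert x D)),
      smul_smul, Finset.card_insert_of_notMem hx, Nat.succ_sub (Finset.card_le_card hS'), pow_succ,
      ← ENNReal.coe_mul]
    congr 2
    ring
  · have hS' := Finset.mem_powerset.mp hS
    rw [poissonSample_apply hS', poissonSample_apply (Finset.insert_subset_insert x hS'),
      smul_smul, Finset.card_insert_of_notMem hx,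
      Finset.card_insert_of_notMem (fun h => hx (hS' h)), Nat.add_sub_add_right, pow_succ,
      ← ENNReal.coe_mul]
    congr 2
    ring

theorem sum_fixedSizeSample {O : Type*} [MeasurableSpace O] {q : ℝ≥0} (hq : q ≤ 1) (D : Finset X)
    (f : Finset X → Measure O) :
    ∑ S ∈ D.powerset, fixedSizeSample q hq D S • f S =
      ((D.card.choose ⌊q * (D.card : ℝ≥0)⌋₊ : ℝ≥0∞))⁻¹ •
        ∑ S ∈ D.powersetCard ⌊q * (D.card : ℝ≥0)⌋₊, f S := by
  have hsub : D.powersetCard ⌊q * (D.card : ℝ≥0)⌋₊ ⊆ D.powerset :=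
    fun S hS => Finset.mem_powerset.mpr (Finset.mem_powersetCard.mp hS).1
  rw [← Finset.sum_subset hsub, Finset.smul_sum]
  · refine Finset.sum_congr rfl fun S hS => ?_
    rw [fixedSizeSample, PMF.uniformOfFinset_apply, if_pos hS, Finset.card_powersetCard]
  · intro S _ hS
    rw [fixedSizeSample, PMF.uniformOfFinset_apply, if_neg hS, zero_smul]

end Sums

/-! ### One round on sampled clients -/

section Round

variable {X : Type*} {k d : ℕ}

instance (R : RoundMechanism X k d) (S : Finset X) : IsMarkovKernel (R.toKernel S) := R.markov S

theorem RoundMechanism.IsRoundRDP.renyiDiv_le {R : RoundMechanism X k d}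
    {Adj : Finset X → Finset X → Prop} {α : ℕ} {ε : ℝ≥0∞ → ℝ≥0∞} (h : R.IsRoundRDP Adj α ε)
    (θ : Models k d) {S S' : Finset X} (hS : S = S' ∨ Adj S S') {j : ℕ} (hj : 2 ≤ j)
    (hjα : j ≤ α) :
    renyiDiv (j : ℝ≥0∞) (R.toKernel S θ) (R.toKernel S' θ) ≤ (ε j : EReal) := by
  rcases hS with rfl | hS
  · exact renyiDiv_self_le _ _ _
  · exact (h θ).1 j hj hjα S S' hS

theorem RoundMechanism.IsRoundRDP.renyiDiv_top_le {R : RoundMechanism X k d}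
    {Adj : Finset X → Finset X → Prop} {α : ℕ} {ε : ℝ≥0∞ → ℝ≥0∞} (h : R.IsRoundRDP Adj α ε)
    (θ : Models k d) {S S' : Finset X} (hS : S = S' ∨ Adj S S') :
    renyiDiv ⊤ (R.toKernel S θ) (R.toKernel S' θ) ≤ (ε ⊤ : EReal) := by
  rcases hS with rfl | hS
  · exact renyiDiv_self_le _ _ _
  · exact (h θ).2 S S' hS

theorem isProbabilityMeasure_sum_smul {O ι : Type*} [MeasurableSpace O] {s : Finset ι}
    {w : ι → ℝ≥0∞} (hw : ∑ i ∈ s, w i = 1) (μ : ι → Measure O)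
    [∀ i, IsProbabilityMeasure (μ i)] : IsProbabilityMeasure (∑ i ∈ s, w i • μ i) :=
  ⟨by simpa [Measure.finsetSum_apply] using hw⟩

theorem isMarkovKernel_sampledRound {sample : Finset X → PMF (Finset X)} {D : Finset X}
    (h : ∑ S ∈ D.powerset, sample D S = 1) (R : RoundMechanism X k d) :
    IsMarkovKernel (sampledRound sample R D) :=
  ⟨fun θ => isProbabilityMeasure_sum_smul h fun S => R.toKernel S θ⟩

variable [DecidableEq X]

theorem sum_fixedSizeSample_eq_one (q : ℝ≥0) (hq : q ≤ 1) (D : Finset X) :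
    ∑ S ∈ D.powerset, fixedSizeSample q hq D S = 1 := by
  rw [← (fixedSizeSample q hq D).tsum_coe, tsum_eq_sum]
  intro S hS
  rw [fixedSizeSample, PMF.uniformOfFinset_apply, if_neg]
  exact fun h => hS (Finset.mem_powerset.mpr (Finset.mem_powersetCard.mp h).1)

theorem addRemove_insert {S : Finset X} {x : X} (hx : x ∉ S) : AddRemove S (insert x S) :=
  ⟨x, Or.inl ⟨hx, rfl⟩⟩

theorem addRemove_insert_left {S : Finset X} {x : X} (hx : x ∉ S) : AddRemove (insert x S) S :=
  ⟨x, Or.inr ⟨hx, rfl⟩⟩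

theorem eq_or_replaceOne {J : Finset X} {x y : X} (hx : x ∉ J) (hy : y ∉ J) :
    insert x J = insert y J ∨ ReplaceOne (insert x J) (insert y J) := by
  rcases eq_or_ne x y with rfl | h
  · exact Or.inl rfl
  · exact Or.inr ⟨J, x, y, hx, hy, h, rfl, rfl⟩

theorem sub_smul_add_smul {O : Type*} [MeasurableSpace O] {q : ℝ≥0} (hq : q ≤ 1)
    (μ : Measure O) : ((1 - q : ℝ≥0) : ℝ≥0∞) • μ + (q : ℝ≥0∞) • μ = μ := by
  rw [← add_smul, ← ENNReal.coe_add, tsub_add_cancel_of_le hq, ENNReal.coe_one, one_smul]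

variable {R : RoundMechanism X k d} {α : ℕ} {ε : ℝ≥0∞ → ℝ≥0∞} {q : ℝ≥0}

/-- The law on `insert x D` is `1 - q` times the law on `D` plus `q` times the mixture with `x`
forced in. Hence `g = q`, and `κ` and `ρ` coincide. -/
theorem momentBound_poisson_insert (hα : 2 ≤ α) (hq : q ≤ 1) (hR : R.IsRoundRDP AddRemove α ε)
    (hM : momentSum q ε α ≠ ⊤) {D : Finset X} {x : X} (hx : x ∉ D) (θ : Models k d) :
    MomentBound α (momentSum q ε α) (sampledRound (poissonSample q hq) R (insert x D) θ)
      (sampledRound (poissonSample q hq) R D θ) := by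
  have hmem : ∀ S ∈ D.powerset, x ∉ S := fun S hS h => hx (Finset.mem_powerset.mp hS h)
  have := isMarkovKernel_sampledRound (sum_poissonSample q hq (insert x D)) R
  refine MomentBound.of_mixture (s := D.powerset) (π := fun S => R.toKernel (insert x S) θ)
    (κ := fun S => R.toKernel S θ) (ρ := fun S => R.toKernel S θ) hα
    (sum_poissonSample q hq D) rfl ?_
    (fun S hS j hj hjα => hR.renyiDiv_le θ (Or.inr (addRemove_insert_left (hmem S hS))) hj hjα)
    (fun S hS j hj hjα => hR.renyiDiv_le θ (Or.inl rfl) hj hjα)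
    (fun S hS => hR.renyiDiv_top_le θ (Or.inr (addRemove_insert_left (hmem S hS))))
    (fun S hS => hR.renyiDiv_top_le θ (Or.inr (addRemove_insert (hmem S hS)))) hM
  change ∑ S ∈ (insert x D).powerset, poissonSample q hq (insert x D) S • R.toKernel S θ + _ = _
  rw [sum_poissonSample_insert hq hx, add_right_comm, sub_smul_add_smul hq]
  rfl

/-- Now the larger client set is the reference, and its components are of two kinds. The index `(S,
b)` records by `b` whether `x` is selected, so that each component `ρ` equals one of `π`, `κ` and is
adjacent to the other. -/
theorem momentBound_poisson_erase (hα : 2 ≤ α) (hq : q ≤ 1) (hR : R.IsRoundRDP AddRemove α ε)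
    (hM : momentSum q ε α ≠ ⊤) {D : Finset X} {x : X} (hx : x ∉ D) (θ : Models k d) :
    MomentBound α (momentSum q ε α) (sampledRound (poissonSample q hq) R D θ)
      (sampledRound (poissonSample q hq) R (insert x D) θ) := by
  have hmem : ∀ S ∈ D.powerset, x ∉ S := fun S hS h => hx (Finset.mem_powerset.mp hS h)
  have := isMarkovKernel_sampledRound (sum_poissonSample q hq D) R
  have hsum : ∀ f : Finset X → Bool → Measure (Models k d),
      ∑ i ∈ D.powerset ×ˢ (Finset.univ : Finset Bool),
        (poissonSample q hq D i.1 * if i.2 then (q : ℝ≥0∞) else ((1 - q : ℝ≥0) : ℝ≥0∞)) •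
          f i.1 i.2 =
      ((1 - q : ℝ≥0) : ℝ≥0∞) • ∑ S ∈ D.powerset, poissonSample q hq D S • f S false +
        (q : ℝ≥0∞) • ∑ S ∈ D.powerset, poissonSample q hq D S • f S true := by
    intro f
    rw [Finset.sum_product, Finset.smul_sum, Finset.smul_sum, ← Finset.sum_add_distrib]
    refine Finset.sum_congr rfl fun S _ => ?_
    rw [Fintype.sum_bool, add_comm]
    simp only [smul_smul, mul_comm, if_true, Bool.false_eq_true, if_false]
  have hν : sampledRound (poissonSample q hq) R (insert x D) θ =
      ∑ i ∈ D.powerset ×ˢ (Finset.univ : Finset Bool),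
        (poissonSample q hq D i.1 * if i.2 then (q : ℝ≥0∞) else ((1 - q : ℝ≥0) : ℝ≥0∞)) •
          R.toKernel (if i.2 then insert x i.1 else i.1) θ := by
    rw [hsum fun S b => R.toKernel (if b then insert x S else S) θ]
    exact sum_poissonSample_insert hq hx fun S => R.toKernel S θ
  have hrel : ∀ i ∈ D.powerset ×ˢ (Finset.univ : Finset Bool),
      (i.1 = (if i.2 then insert x i.1 else i.1) ∨
        AddRemove i.1 (if i.2 then insert x i.1 else i.1)) ∧
      (insert x i.1 = (if i.2 then insert x i.1 else i.1) ∨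
        AddRemove (insert x i.1) (if i.2 then insert x i.1 else i.1)) := by
    rintro ⟨S, b⟩ hi
    have hS := hmem S (Finset.mem_product.mp hi).1
    cases b
    · exact ⟨Or.inl rfl, Or.inr (addRemove_insert_left hS)⟩
    · exact ⟨Or.inr (addRemove_insert hS), Or.inl rfl⟩
  have hxi : ∀ i ∈ D.powerset ×ˢ (Finset.univ : Finset Bool), x ∉ i.1 :=
    fun i hi => hmem i.1 (Finset.mem_product.mp hi).1
  refine MomentBound.of_mixture (s := D.powerset ×ˢ (Finset.univ : Finset Bool))
    (w := fun i => poissonSample q hq D i.1 *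
      if i.2 then (q : ℝ≥0∞) else ((1 - q : ℝ≥0) : ℝ≥0∞))
    (π := fun i => R.toKernel i.1 θ)
    (κ := fun i => R.toKernel (insert x i.1) θ)
    (ρ := fun i => R.toKernel (if i.2 then insert x i.1 else i.1) θ) hα ?_ hν ?_
    (fun i hi j hj hjα => hR.renyiDiv_le θ (hrel i hi).1 hj hjα)
    (fun i hi j hj hjα => hR.renyiDiv_le θ (hrel i hi).2 hj hjα)
    (fun i hi => hR.renyiDiv_top_le θ (Or.inr (addRemove_insert (hxi i hi))))
    (fun i hi => hR.renyiDiv_top_le θ (Or.inr (addRemove_insert_left (hxi i hi)))) hM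
  · rw [Finset.sum_product, ← sum_poissonSample q hq D]
    refine Finset.sum_congr rfl fun S _ => ?_
    dsimp only
    rw [← Finset.mul_sum, Fintype.sum_bool, if_pos rfl, if_neg (by simp), ← ENNReal.coe_add,
      add_tsub_cancel_of_le hq, ENNReal.coe_one, mul_one]
  · rw [hsum fun S _ => R.toKernel S θ, hsum fun S _ => R.toKernel (insert x S) θ,
      sub_smul_add_smul hq, sub_smul_add_smul hq]
    change ∑ S ∈ D.powerset, poissonSample q hq D S • R.toKernel S θ + _ =
      ∑ S ∈ (insert x D).powerset, poissonSample q hq (insert x D) S • R.toKernel S θ + _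
    rw [sum_poissonSample_insert hq hx, add_right_comm, sub_smul_add_smul hq]

theorem momentBound_poisson (hα : 2 ≤ α) (hq : q ≤ 1) (hR : R.IsRoundRDP AddRemove α ε)
    (hM : momentSum q ε α ≠ ⊤) {D D' : Finset X} (hD : AddRemove D D') (θ : Models k d) :
    MomentBound α (momentSum q ε α) (sampledRound (poissonSample q hq) R D θ)
      (sampledRound (poissonSample q hq) R D' θ) := by
  obtain ⟨x, ⟨hx, rfl⟩ | ⟨hx, rfl⟩⟩ := hD
  · exact momentBound_poisson_erase hα hq hR hM hx θ
  · exact momentBound_poisson_insert hα hq hR hM hx θ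

theorem momentBound_self {O : Type*} [MeasurableSpace O] (hα : 2 ≤ α)
    (hM : momentSum q ε α ≠ ⊤) (μ : Measure O) [IsProbabilityMeasure μ] :
    MomentBound α (momentSum q ε α) μ μ := by
  have h := MomentBound.of_mixture (O := O) (ι := Unit) (s := Finset.univ) (w := fun _ => 1)
    (π := fun _ => μ) (κ := fun _ => μ) (ρ := fun _ => μ) (μ := μ) (g := q) (ε := ε) hα (by simp)
    rfl (by simp) (fun _ _ _ _ _ => renyiDiv_self_le _ _ _) (fun _ _ _ _ _ => renyiDiv_self_le _ _ _)
    (fun _ _ => renyiDiv_self_le _ _ _) (fun _ _ => renyiDiv_self_le _ _ _) hM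
  simpa using h

/-- The two laws differ only through samples containing `x` or `y`, that is, through `insert x J`
against `insert y J` for `J ⊆ D₀`. Components of the reference law are indexed by `(J, z)` with
sample `insert z J`, which is equal or adjacent to both of these. -/
theorem momentBound_fixedSize (hα : 2 ≤ α) (hq : q ≤ 1) (hR : R.IsRoundRDP ReplaceOne α ε)
    (hM : momentSum q ε α ≠ ⊤) {D D' : Finset X} (hD : ReplaceOne D D') (θ : Models k d) :
    MomentBound α (momentSum q ε α) (sampledRound (fixedSizeSample q hq) R D θ)
      (sampledRound (fixedSizeSample q hq) R D' θ) := by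
  have hmarkov := isMarkovKernel_sampledRound (sum_fixedSizeSample_eq_one q hq D) R
  obtain ⟨D₀, x, y, hx, hy, -, rfl, rfl⟩ := hD
  have e : ∀ z, z ∉ D₀ → sampledRound (fixedSizeSample q hq) R (insert z D₀) θ =
      ((D₀.card + 1).choose ⌊q * ((D₀.card + 1 : ℕ) : ℝ≥0)⌋₊ : ℝ≥0∞)⁻¹ •
        ∑ S ∈ (insert z D₀).powersetCard ⌊q * ((D₀.card + 1 : ℕ) : ℝ≥0)⌋₊, R.toKernel S θ := by
    intro z hz
    rw [← Finset.card_insert_of_notMem hz]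
    exact sum_fixedSizeSample hq (insert z D₀) fun S => R.toKernel S θ
  have hfloor : ((⌊q * ((D₀.card + 1 : ℕ) : ℝ≥0)⌋₊ : ℕ) : ℝ≥0) ≤ q * ((D₀.card + 1 : ℕ) : ℝ≥0) :=
    Nat.floor_le zero_le
  have hprob : IsProbabilityMeasure (sampledRound (fixedSizeSample q hq) R (insert x D₀) θ) :=
    inferInstance
  generalize ⌊q * ((D₀.card + 1 : ℕ) : ℝ≥0)⌋₊ = m' at e hfloor
  -- If the sample size rounds down to 0, both rounds use the empty sample and have the same law.
  rcases m' with _ | m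
  · have : sampledRound (fixedSizeSample q hq) R (insert x D₀) θ =
        sampledRound (fixedSizeSample q hq) R (insert y D₀) θ := by
      rw [e x hx, e y hy]; simp
    rw [← this]
    exact momentBound_self hα hM _
  set n := D₀.card with hn
  set N : ℝ≥0∞ := ((n + 1).choose (m + 1) : ℝ≥0∞) with hN
  have hmn : m ≤ n := by
    have h1 : ((m + 1 : ℕ) : ℝ≥0) ≤ ((n + 1 : ℕ) : ℝ≥0) :=
      hfloor.trans (mul_le_of_le_one_left zero_le hq)
    have h2 : m + 1 ≤ n + 1 := by exact_mod_cast h1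
    omega
  have hN0 : N ≠ 0 := by
    rw [hN]; exact_mod_cast (Nat.choose_pos (by omega)).ne'
  have hNt : N ≠ ⊤ := ENNReal.natCast_ne_top _
  have hm0 : ((m + 1 : ℕ) : ℝ≥0∞) ≠ 0 := by exact_mod_cast Nat.succ_ne_zero m
  have hmt : ((m + 1 : ℕ) : ℝ≥0∞) ≠ ⊤ := ENNReal.natCast_ne_top _
  -- The probability that a given client is selected; because of the rounding it may be less than
  -- `q`.
  set g : ℝ≥0 := ((m + 1 : ℕ) : ℝ≥0) / ((n + 1 : ℕ) : ℝ≥0) with hg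
  have hgq : g ≤ q := div_le_of_le_mul₀ zero_le zero_le hfloor
  -- Total weight of a fixed `J`. It equals `1 / n.choose m`, so `J` is uniform.
  set a : ℝ≥0∞ := N⁻¹ * (((m + 1 : ℕ) : ℝ≥0∞)⁻¹ * ((n + 1 : ℕ) : ℝ≥0∞)) with ha
  have hga : (g : ℝ≥0∞) * a = N⁻¹ := by
    have hn0 : ((n + 1 : ℕ) : ℝ≥0∞) ≠ 0 := by exact_mod_cast Nat.succ_ne_zero n
    have hnt : ((n + 1 : ℕ) : ℝ≥0∞) ≠ ⊤ := ENNReal.natCast_ne_top _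
    rw [hg, ENNReal.coe_div (by exact_mod_cast Nat.succ_ne_zero n), ENNReal.coe_natCast,
      ENNReal.coe_natCast, ha, div_eq_mul_inv]
    calc _ = N⁻¹ * (((m + 1 : ℕ) : ℝ≥0∞) * ((m + 1 : ℕ) : ℝ≥0∞)⁻¹) *
          (((n + 1 : ℕ) : ℝ≥0∞) * ((n + 1 : ℕ) : ℝ≥0∞)⁻¹) := by ring
      _ = N⁻¹ := by
        rw [ENNReal.mul_inv_cancel hm0 hmt, ENNReal.mul_inv_cancel hn0 hnt, mul_one, mul_one]
  -- A sample has mass `N⁻¹`. If it contains `y`, all of it goes to `z = y`; otherwise it is shared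
  -- equally among the `m + 1` members that can be removed.
  set w : (_ : Finset X) × X → ℝ≥0∞ :=
    fun i => if i.2 = y then N⁻¹ else N⁻¹ * ((m + 1 : ℕ) : ℝ≥0∞)⁻¹ with hwdef
  set s : Finset ((_ : Finset X) × X) :=
    (D₀.powersetCard m).sigma fun J => insert y (D₀ \ J) with hs
  have hyJ : ∀ J : Finset X, y ∉ D₀ \ J := fun J h => hy (Finset.mem_sdiff.mp h).1
  have hwz : ∀ J, ∀ z ∈ D₀ \ J, w ⟨J, z⟩ = N⁻¹ * ((m + 1 : ℕ) : ℝ≥0∞)⁻¹ := by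
    intro J z hz
    exact if_neg fun h : z = y => hyJ J (h ▸ hz)
  have hwy : ∀ J, w ⟨J, y⟩ = N⁻¹ := fun J => if_pos rfl
  have hwJ : ∀ J ∈ D₀.powersetCard m, ∑ z ∈ insert y (D₀ \ J), w ⟨J, z⟩ = a := by
    intro J hJ
    obtain ⟨hJ1, hJ2⟩ := Finset.mem_powersetCard.mp hJ
    rw [Finset.sum_insert (hyJ J), hwy, Finset.sum_congr rfl (hwz J), Finset.sum_const,
      Finset.card_sdiff_of_subset hJ1, hJ2, nsmul_eq_mul, ha]
    have h1 : ((n + 1 : ℕ) : ℝ≥0∞) = ((m + 1 : ℕ) : ℝ≥0∞) + ((n - m : ℕ) : ℝ≥0∞) := by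
      rw [← Nat.cast_add]; congr 1; omega
    rw [h1, mul_add _ ((m + 1 : ℕ) : ℝ≥0∞), ENNReal.inv_mul_cancel hm0 hmt]
    ring
  have hconst : ∀ f : Finset X → Measure (Models k d),
      ∑ i ∈ s, w i • f i.1 = a • ∑ J ∈ D₀.powersetCard m, f J := by
    intro f
    rw [hs, Finset.sum_sigma, Finset.smul_sum]
    refine Finset.sum_congr rfl fun J hJ => ?_
    rw [← hwJ J hJ, Finset.sum_smul]
  have hρ : ∑ i ∈ s, w i • R.toKernel (insert i.2 i.1) θ =
      N⁻¹ • ∑ S ∈ D₀.powersetCard (m + 1), R.toKernel S θ +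
        N⁻¹ • ∑ J ∈ D₀.powersetCard m, R.toKernel (insert y J) θ := by
    rw [hs, Finset.sum_sigma]
    have h1 : ∀ J ∈ D₀.powersetCard m,
        ∑ z ∈ insert y (D₀ \ J), w ⟨J, z⟩ • R.toKernel (insert z J) θ =
        N⁻¹ • R.toKernel (insert y J) θ +
          (N⁻¹ * ((m + 1 : ℕ) : ℝ≥0∞)⁻¹) • ∑ z ∈ D₀ \ J, R.toKernel (insert z J) θ := by
      intro J hJ
      rw [Finset.sum_insert (hyJ J), hwy, Finset.smul_sum]
      congr 1
      exact Finset.sum_congr rfl fun z hz => by rw [hwz J z hz]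
    rw [Finset.sum_congr rfl h1, Finset.sum_add_distrib, ← Finset.smul_sum, ← Finset.smul_sum,
      sum_powersetCard_sum_sdiff_insert D₀ m fun S => R.toKernel S θ, ← Nat.cast_smul_eq_nsmul ℝ≥0∞,
      smul_smul, mul_assoc, ENNReal.inv_mul_cancel hm0 hmt, mul_one, add_comm]
  have hν : sampledRound (fixedSizeSample q hq) R (insert y D₀) θ =
      ∑ i ∈ s, w i • R.toKernel (insert i.2 i.1) θ := by
    rw [hρ, e y hy, sum_powersetCard_insert hy, smul_add]
  have hmem : ∀ i ∈ s, x ∉ i.1 ∧ y ∉ i.1 ∧ i.2 ∉ i.1 := by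
    rintro ⟨J, z⟩ hi
    obtain ⟨hJ, hz⟩ := Finset.mem_sigma.mp hi
    have hJD := (Finset.mem_powersetCard.mp hJ).1
    refine ⟨fun h => hx (hJD h), fun h => hy (hJD h), ?_⟩
    rcases Finset.mem_insert.mp hz with h | h
    · exact fun h' => hy (hJD (h ▸ h'))
    · exact (Finset.mem_sdiff.mp h).2
  refine (MomentBound.of_mixture (s := s) (w := w) (g := g)
    (π := fun i => R.toKernel (insert x i.1) θ)
    (κ := fun i => R.toKernel (insert y i.1) θ)
    (ρ := fun i => R.toKernel (insert i.2 i.1) θ) hα ?_ hν ?_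
    (fun i hi j hj hjα => hR.renyiDiv_le θ (eq_or_replaceOne (hmem i hi).1 (hmem i hi).2.2) hj hjα)
    (fun i hi j hj hjα =>
      hR.renyiDiv_le θ (eq_or_replaceOne (hmem i hi).2.1 (hmem i hi).2.2) hj hjα)
    (fun i hi => hR.renyiDiv_top_le θ (eq_or_replaceOne (hmem i hi).1 (hmem i hi).2.1))
    (fun i hi => hR.renyiDiv_top_le θ (eq_or_replaceOne (hmem i hi).2.1 (hmem i hi).1))
    (ne_top_of_le_ne_top hM (momentSum_mono hgq ε α))).mono (momentSum_mono hgq ε α)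
  · rw [hs, Finset.sum_sigma, Finset.sum_congr rfl hwJ, Finset.sum_const,
      Finset.card_powersetCard, nsmul_eq_mul, ha]
    have h1 : ((n + 1 : ℕ) : ℝ≥0∞) * (n.choose m : ℝ≥0∞) = N * ((m + 1 : ℕ) : ℝ≥0∞) := by
      rw [hN]; exact_mod_cast Nat.add_one_mul_choose_eq n m
    calc _ = N⁻¹ * ((m + 1 : ℕ) : ℝ≥0∞)⁻¹ * (((n + 1 : ℕ) : ℝ≥0∞) * (n.choose m : ℝ≥0∞)) := by
          rw [← hn]; ring
      _ = N * N⁻¹ * (((m + 1 : ℕ) : ℝ≥0∞) * ((m + 1 : ℕ) : ℝ≥0∞)⁻¹) := by rw [h1]; ring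
      _ = 1 := by rw [ENNReal.mul_inv_cancel hN0 hNt, ENNReal.mul_inv_cancel hm0 hmt, mul_one]
  · rw [hν, hρ, hconst fun J => R.toKernel (insert y J) θ, hconst fun J => R.toKernel (insert x J) θ,
      smul_smul, smul_smul, hga, e x hx, sum_powersetCard_insert hx, smul_add, add_right_comm]

end Round

/-! ### Composition of the rounds -/

section Composition

variable {X : Type*} {k d : ℕ} {sample : Finset X → PMF (Finset X)} {R : RoundMechanism X k d}

theorem isProbabilityMeasure_runRounds (hs : ∀ D : Finset X, ∑ S ∈ D.powerset, sample D S = 1)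
    (θ₀ : Models k d) (D : Finset X) :
    ∀ T, IsProbabilityMeasure (runRounds sample R θ₀ D T)
  | 0 => inferInstanceAs (IsProbabilityMeasure (Measure.dirac θ₀))
  | T + 1 => by
    have := isProbabilityMeasure_runRounds hs θ₀ D T
    have := isMarkovKernel_sampledRound (hs D) R
    rw [runRounds]
    infer_instance

theorem momentBound_runRounds {α : ℕ} (hα : α ≠ 0) {c : ℝ≥0∞} {D D' : Finset X}
    (h : ∀ θ, MomentBound α c (sampledRound sample R D θ) (sampledRound sample R D' θ))
    (θ₀ : Models k d) :
    ∀ T, MomentBound α (c ^ T) (runRounds sample R θ₀ D T) (runRounds sample R θ₀ D' T)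
  | 0 => by rw [pow_zero]; exact momentBound_dirac α θ₀
  | T + 1 => by rw [pow_succ]; exact (momentBound_runRounds hα h θ₀ T).bind hα h

theorem isRDP_runRounds {Adj : Finset X → Finset X → Prop} {α : ℕ} (hα : 2 ≤ α) {q : ℝ≥0}
    {ε : ℝ≥0∞ → ℝ≥0∞} (hs : ∀ D : Finset X, ∑ S ∈ D.powerset, sample D S = 1)
    (h : momentSum q ε α ≠ ⊤ → ∀ D D', Adj D D' → ∀ θ, MomentBound α (momentSum q ε α)
      (sampledRound sample R D θ) (sampledRound sample R D' θ)) (θ₀ : Models k d) (T : ℕ) :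
    IsRDP Adj (fun D => runRounds sample R θ₀ D T) (α : ℝ≥0∞) (totalLevel q ε T α) := by
  intro D D' hD
  have hα1 : (0 : ℝ) < (α : ℝ) - 1 := by
    have : (2 : ℝ) ≤ α := by exact_mod_cast hα
    linarith
  have := isProbabilityMeasure_runRounds (R := R) hs θ₀ D T
  have := isProbabilityMeasure_runRounds (R := R) hs θ₀ D' T
  -- No rounds: the level is 0 even if the moment sum is infinite, so this case cannot rely on a
  -- vacuous bound.
  rcases Nat.eq_zero_or_pos T with rfl | hT
  · refine ((momentBound_dirac α θ₀).renyiDiv_le hα).trans_eq ?_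
    simp [totalLevel]
  by_cases hM : momentSum q ε α = ⊤
  · rw [totalLevel, hM, ENNReal.log_top, EReal.coe_mul_top_of_pos]
    · exact le_top
    · have : (0 : ℝ) < T := by exact_mod_cast hT
      positivity
  · refine ((momentBound_runRounds (by omega) (h hM D D' hD) θ₀ T).renyiDiv_le hα).trans_eq ?_
    rw [ENNReal.log_pow, totalLevel, ← mul_assoc, ← EReal.coe_coe_eq_natCast, ← EReal.coe_mul,
      div_eq_inv_mul]

end Composition

end RRC

/-- The first part is for an arbitrary round mechanism on the selected clients, the second one for
the round of RR-Cluster. In each part, the first item is for Poisson sampling and add/remove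
adjacency, the second one for sampling without replacement and replace-one adjacency. -/
theorem theorem1 {X : Type*} [DecidableEq X] {k d : ℕ}
    {S S' : Type*} [MeasurableSpace S] [MeasurableSpace S']
    (ε₁ ε₂ : ENNReal → ENNReal) (q : NNReal) (hq : q ≤ 1) (T α : ℕ) (hα : 2 ≤ α)
    (θ₀ : RRC.Models k d) :
    (∀ R : RRC.RoundMechanism X k d,
      (R.IsRoundRDP RRC.AddRemove α (fun a => ε₁ a + ε₂ a) →
        RRC.IsRDP RRC.AddRemove (fun D => RRC.runRounds (RRC.poissonSample q hq) R θ₀ D T)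
          (α : ENNReal) (RRC.totalLevel q (fun a => ε₁ a + ε₂ a) T α)) ∧
      (R.IsRoundRDP RRC.ReplaceOne α (fun a => ε₁ a + ε₂ a) →
        RRC.IsRDP RRC.ReplaceOne (fun D => RRC.runRounds (RRC.fixedSizeSample q hq) R θ₀ D T)
          (α : ENNReal) (RRC.totalLevel q (fun a => ε₁ a + ε₂ a) T α))) ∧
    (∀ A : RRC.RRCluster X k d S S',
      (A.round.IsRoundRDP RRC.AddRemove α (fun a => ε₁ a + ε₂ a) →
        RRC.IsRDP RRC.AddRemove
          (fun D => RRC.runRounds (RRC.poissonSample q hq) A.round θ₀ D T)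
          (α : ENNReal) (RRC.totalLevel q (fun a => ε₁ a + ε₂ a) T α)) ∧
      (A.round.IsRoundRDP RRC.ReplaceOne α (fun a => ε₁ a + ε₂ a) →
        RRC.IsRDP RRC.ReplaceOne
          (fun D => RRC.runRounds (RRC.fixedSizeSample q hq) A.round θ₀ D T)
          (α : ENNReal) (RRC.totalLevel q (fun a => ε₁ a + ε₂ a) T α))) := by
  have h : ∀ R : RRC.RoundMechanism X k d,
      (R.IsRoundRDP RRC.AddRemove α (fun a => ε₁ a + ε₂ a) →
        RRC.IsRDP RRC.AddRemove (fun D => RRC.runRounds (RRC.poissonSample q hq) R θ₀ D T)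
          (α : ENNReal) (RRC.totalLevel q (fun a => ε₁ a + ε₂ a) T α)) ∧
      (R.IsRoundRDP RRC.ReplaceOne α (fun a => ε₁ a + ε₂ a) →
        RRC.IsRDP RRC.ReplaceOne (fun D => RRC.runRounds (RRC.fixedSizeSample q hq) R θ₀ D T)
          (α : ENNReal) (RRC.totalLevel q (fun a => ε₁ a + ε₂ a) T α)) := fun R =>
    ⟨fun hR => RRC.isRDP_runRounds hα (RRC.sum_poissonSample q hq)
        (fun hM _ _ hD θ => RRC.momentBound_poisson hα hq hR hM hD θ) θ₀ T,
      fun hR => RRC.isRDP_runRounds hα (RRC.sum_fixedSizeSample_eq_one q hq)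
        (fun hM _ _ hD θ => RRC.momentBound_fixedSize hα hq hR hM hD θ) θ₀ T⟩
  exact ⟨h, fun A => h A.round⟩
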